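/- Let $T=\mathbb{C}/\Lambda$ be a flat torus, $\Lambda\subset\mathbb{C}$ a lattice of rank two. Let $\Gamma$ be a finite bipartite graph (each edge joins a white vertex to a black vertex; multiple edges are allowed) without univalent vertices, embedded in $T$ in such a way that every edge is a straight (geodesic) segment and every face, i.e. every connected component of $T\setminus\Gamma$, is contractible. Let $\Gamma$ be endowed with a perfect orientation, i.e. an orientation of its edges such that every white vertex has exactly one incoming edge and every black vertex has exactly one outgoing edge. For an edge $e$ oriented from white to black, let $e_-$ be the unique edge coming into its white end and $e_+$ the unique edge going out of its black end, let $\alpha_-,\alpha_+\in(-\pi,\pi)$ be the signed angles from the vector $e_-$ to the vector $e$ and from $e$ to $e_+$ respectively, and let $$\mathrm{turn}(e)=\exp\left(\tfrac{\mathrm{i}}{2}(\alpha_-+\alpha_+)\right).$$ Put $k(e)=\mathrm{turn}(e)$ if $e$ is oriented from white to black, and $k(e)=-1$ if $e$ is oriented from black to white. Then $k$ is a fractional Kasteleyn marking, that is: 1. $k(e)\neq 0$ for every edge $e$; 2. for every face $f$, the alternating product of $k$ around $f$ is equal to $(-1)^{l(f)/2+1}$, where $l(f)$ is the (even) number of vertices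 of $f$; 3. the alternating product of $k$ along every cycle (closed walk) of $\Gamma$ is $1$ or $-1$. Here the alternating product along a closed walk is the product of $k(e)$ over the edges traversed from white to black times the product of $k(e)^{-1}$ over the edges traversed from black to white. If the boundary of $f$ is not an embedded polygon, the vertices and edges of $f$ are counted with multiplicity, i.e. as those of the polygon whose image under a cellular map is the closure of $f$. -/

import Mathlib

open Complex Set Filter Topology

noncomputable section

/-- The flat torus `ℂ / Λ`, where `Λ` is a lattice in the Euclidean plane `ℂ`. -/
abbrev FlatTorus (Λ : Submodule ℤ ℂ) : Type := ℂ ⧸ Λ.toAddSubgroup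

/-- A bipartite multigraph with white vertices `W`, black vertices `B` and edges `E`, mapped to
the flat torus `ℂ / Λ` so that every edge is a straight (geodesic) segment. The complex number
`vec e` is the developed displacement along `e`, from its white end to its black end. No
embeddedness is required here; see `StraightGraph.IsToric`. -/
structure StraightGraph (Λ : Submodule ℤ ℂ) (W B E : Type*) where
  /-- the white end of an edge -/
  white : E → W
  /-- the black end of an edge -/
  black : E → B
  /-- the position of the vertices on the torus -/
  pos : W ⊕ B → FlatTorus Λ
  /-- the displacement vector of an edge, from white to black -/
  vec : E → ℂ
  pos_black : ∀ e, pos (Sum.inr (black e)) =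
    pos (Sum.inl (white e)) + (QuotientAddGroup.mk (vec e) : FlatTorus Λ)

namespace StraightGraph

variable {Λ : Submodule ℤ ℂ} {W B E : Type*}

/-- The point of the edge `e` at parameter `t ∈ [0, 1]`, from white (`t = 0`) to black (`t = 1`). -/
def edgePoint (G : StraightGraph Λ W B E) (e : E) (t : ℝ) : FlatTorus Λ :=
  G.pos (Sum.inl (G.white e)) + (QuotientAddGroup.mk ((t : ℂ) * G.vec e) : FlatTorus Λ)

/-- The subset of the torus covered by the vertices and the edges. -/
def support (G : StraightGraph Λ W B E) : Set (FlatTorus Λ) :=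
  range G.pos ∪ ⋃ e, G.edgePoint e '' Icc 0 1

/-- The faces: the connected components of the complement of the graph. -/
def IsFace (G : StraightGraph Λ W B E) (f : Set (FlatTorus Λ)) : Prop :=
  ∃ x ∈ G.supportᶜ, f = connectedComponentIn G.supportᶜ x

/-- A toric graph: the drawing is an embedding (distinct vertices have distinct positions, and an
interior point of an edge is not a vertex, nor a point of the same edge at another parameter, nor
an interior point of another edge), and all faces are contractible. -/
structure IsToric (G : StraightGraph Λ W B E) : Prop where
  pos_injective : Function.Injective G.pos
  edgePoint_ne_pos : ∀ e, ∀ t ∈ Ioo (0 : ℝ) 1, ∀ v, G.edgePoint e t ≠ G.pos v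
  edgePoint_injective : ∀ e e' : E, ∀ t ∈ Ioo (0 : ℝ) 1, ∀ t' ∈ Ioo (0 : ℝ) 1,
    G.edgePoint e t = G.edgePoint e' t' → e = e' ∧ t = t'
  contractible_of_isFace : ∀ f, G.IsFace f → ContractibleSpace f

/-- There are no univalent vertices. -/
def IsLeafless (G : StraightGraph Λ W B E) : Prop :=
  (∀ w : W, {e | G.white e = w}.ncard ≠ 1) ∧ (∀ b : B, {e | G.black e = b}.ncard ≠ 1)

/-! ### Darts, i.e. edges with a direction of traversal

The dart `(e, true)` traverses `e` from white to black, and `(e, false)` from black to white. -/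

/-- The initial vertex of a dart. -/
def dartSrc (G : StraightGraph Λ W B E) (d : E × Bool) : W ⊕ B :=
  if d.2 then Sum.inl (G.white d.1) else Sum.inr (G.black d.1)

/-- The final vertex of a dart. -/
def dartDst (G : StraightGraph Λ W B E) (d : E × Bool) : W ⊕ B :=
  if d.2 then Sum.inr (G.black d.1) else Sum.inl (G.white d.1)

/-- The displacement vector of a dart, from its initial to its final vertex. -/
def dartVec (G : StraightGraph Λ W B E) (d : E × Bool) : ℂ :=
  if d.2 then G.vec d.1 else -G.vec d.1

/-- The set `f` lies immediately to the left of the dart `d`: every point obtained from an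
interior point of `d` by a sufficiently small shift to the left is in `f`. -/
def LiesLeftOf (G : StraightGraph Λ W B E) (f : Set (FlatTorus Λ)) (d : E × Bool) : Prop :=
  ∀ t ∈ Ioo (0 : ℝ) 1, ∀ᶠ s : ℝ in 𝓝[>] 0,
    G.pos (G.dartSrc d) +
      (QuotientAddGroup.mk (((t : ℂ) + (s : ℂ) * I) * G.dartVec d) : FlatTorus Λ) ∈ f

open Classical in
/-- The boundary of a face `f`, traversed counterclockwise: the darts that have `f` on their left.
These are the sides of the polygon `f'` of which the closure of `f` is the image; an edge with `f`
on both of its sides occurs twice, once in each direction. -/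
def faceBoundary [Fintype E] (G : StraightGraph Λ W B E) (f : Set (FlatTorus Λ)) :
    Finset (E × Bool) :=
  Finset.univ.filter fun d => G.LiesLeftOf f d

/-- The number `l(f)` of sides (equivalently, of vertices) of a face. -/
def faceLength [Fintype E] (G : StraightGraph Λ W B E) (f : Set (FlatTorus Λ)) : ℕ :=
  (G.faceBoundary f).card

/-- The factor that a dart contributes to an alternating product of the numbers `k`. Along a walk
in a bipartite graph the two directions alternate, so `k e` and `(k e)⁻¹` alternate as well. -/
def dartFactor (k : E → ℂ) (d : E × Bool) : ℂ :=
  if d.2 then k d.1 else (k d.1)⁻¹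

/-- The darts `d 0, …, d (n - 1)` form a closed walk (with `d n = d 0`). -/
def IsClosedWalk (G : StraightGraph Λ W B E) (n : ℕ) (d : ℕ → E × Bool) : Prop :=
  (∀ i < n, G.dartDst (d i) = G.dartSrc (d (i + 1))) ∧ d n = d 0

/-- A fractional Kasteleyn marking: non-zero complex numbers on the edges such that the
alternating product around every face `f` is `(-1) ^ (l(f) / 2 + 1)`, where `l(f)` is even, and
the alternating product along every cycle is `1` or `-1`. -/
structure IsFractionalKasteleynMarking [Fintype E] (G : StraightGraph Λ W B E) (k : E → ℂ) :
    Prop where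
  ne_zero : ∀ e, k e ≠ 0
  face : ∀ f, G.IsFace f → ∃ m : ℕ, G.faceLength f = 2 * m ∧
    ∏ d ∈ G.faceBoundary f, dartFactor k d = (-1) ^ (m + 1)
  cycle : ∀ (n : ℕ) (d : ℕ → E × Bool), G.IsClosedWalk n d →
    ∏ i ∈ Finset.range n, dartFactor k (d i) = 1 ∨ ∏ i ∈ Finset.range n, dartFactor k (d i) = -1

/-- A perfect orientation: every white vertex has exactly one incoming edge and every black vertex
has exactly one outgoing edge. Here `toBlack e` is `true` if `e` is oriented from white to black,
and `false` if it is oriented from black to white. -/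
structure PerfectOrientation (G : StraightGraph Λ W B E) where
  /-- the direction of each edge -/
  toBlack : E → Bool
  existsUnique_in : ∀ w : W, ∃! e, G.white e = w ∧ toBlack e = false
  existsUnique_out : ∀ b : B, ∃! e, G.black e = b ∧ toBlack e = false

namespace PerfectOrientation

variable {G : StraightGraph Λ W B E}

/-- The edge `e` as a vector pointing in the direction of its orientation. -/
def edgeVec (o : G.PerfectOrientation) (e : E) : ℂ := G.dartVec (e, o.toBlack e)

/-- The predecessor `e₋` of a white-to-black edge: the incoming edge at its white end. -/
def pred (o : G.PerfectOrientation) (e : E) : E :=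
  Classical.choose (o.existsUnique_in (G.white e)).exists

/-- The successor `e₊` of a white-to-black edge: the outgoing edge at its black end. -/
def succ (o : G.PerfectOrientation) (e : E) : E :=
  Classical.choose (o.existsUnique_out (G.black e)).exists

/-- The signed angle `α₋` from the vector of `e₋` to the vector of `e`. -/
def angleMinus (o : G.PerfectOrientation) (e : E) : ℝ :=
  arg (o.edgeVec e / o.edgeVec (o.pred e))

/-- The signed angle `α₊` from the vector of `e` to the vector of `e₊`. -/
def anglePlus (o : G.PerfectOrientation) (e : E) : ℝ :=
  arg (o.edgeVec (o.succ e) / o.edgeVec e)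

/-- The turning number of a white-to-black edge. -/
def turn (o : G.PerfectOrientation) (e : E) : ℂ :=
  exp (I / 2 * ((o.angleMinus e : ℂ) + (o.anglePlus e : ℂ)))

/-- The turning number on the white-to-black edges, and `-1` on the black-to-white edges. -/
def marking (o : G.PerfectOrientation) (e : E) : ℂ :=
  if o.toBlack e then o.turn e else -1

end PerfectOrientation

end StraightGraph

end

/-! At each vertex take as axis the unique black-to-white edge there, pointing away from the vertex,
and attach to every dart leaving the vertex the number `halfTurn`: the exponential of half its
angle, measured by the branch whose cut is the axis. The marking is then almost a coboundary: along
a dart it equals a sign, -1 exactly on black-to-white edges, times the quotient of the half-turns of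
the dart and of its reverse (`dartFactor_marking`).

Cycles. Squaring removes both the sign and the choice of branch: the squared factor of a dart is a
quotient of unit vectors attached to its two end vertices (`dartFactor_marking_sq`). The squares
telescope along a walk, so a closed walk has product 1 or -1.

Faces. Regroup the half-turns by corners instead of by edges. A corner of interior angle θ
contributes exp(-iθ/2), with an extra -1 when the cut lies strictly inside the corner or along its
outgoing side. No edge lies inside a corner, so this happens exactly when the outgoing side is
black-to-white (`halfTurn_div_halfTurn`), and the extra signs cancel the edge signs. What remains is
the angle sum of a polygon, (l - 2)π modulo 4π, even if the boundary is not embedded.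

Angle sum. A contractible face lifts to the plane. Apply the same half-angle device with one fixed
cut, the upward vertical, in coordinates where no edge is vertical. The product becomes a power of i
times a sign, determined by the number of floor sides (those with the region above them) and the
number of corners that contain the upward vertical. The angle sum thus reduces to floor sides =
upward corners + 1 (`card_floorSide`).

This count is an Euler characteristic. The vertical rays above the upward corners cut the region
into cells, one over each floor side; each ray joins the cell on its left to the one on its right,
and the resulting graph must be a tree. In linear terms, the difference map from functions on cells
to functions on rays has only constants in its kernel because the region is connected, and is
surjective because the angle around a vertex is single-valued on the region, which makes each ray
separate it. -/

noncomputable section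

/-! ### Counterclockwise angles and branches of the half-angle -/

/-- The counterclockwise angle from `y` to `x`, in `(0, 2π]`. -/
def ccwAngle (y x : ℂ) : ℝ := arg (-(x / y)) + Real.pi

theorem ccwAngle_pos (y x : ℂ) : 0 < ccwAngle y x := by
  have := Complex.neg_pi_lt_arg (-(x / y))
  unfold ccwAngle; linarith

theorem ccwAngle_le (y x : ℂ) : ccwAngle y x ≤ 2 * Real.pi := by
  have := Complex.arg_le_pi (-(x / y))
  unfold ccwAngle; linarith

theorem ccwAngle_div (y x : ℂ) {c : ℂ} (hc : c ≠ 0) : ccwAngle (y / c) (x / c) = ccwAngle y x := by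
  unfold ccwAngle; rw [div_div_div_cancel_right₀ hc]

theorem exists_eq_mul_exp_ccwAngle {y x : ℂ} (hy : y ≠ 0) (hx : x ≠ 0) :
    ∃ r : ℝ, 0 < r ∧ x = r * y * exp (ccwAngle y x * I) := by
  refine ⟨‖x / y‖, norm_pos_iff.2 (div_ne_zero hx hy), ?_⟩
  have h := Complex.norm_mul_exp_arg_mul_I (-(x / y))
  rw [norm_neg] at h
  have h2 : exp ((ccwAngle y x : ℂ) * I) = - exp (arg (-(x / y)) * I) := by
    unfold ccwAngle
    push_cast
    rw [add_mul, Complex.exp_add, Complex.exp_pi_mul_I]; ring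
  rw [h2]
  have h3 : x = x / y * y := by field_simp
  linear_combination h3 + y * h

theorem ccwAngle_eq {y x : ℂ} (hy : y ≠ 0) {r θ : ℝ} (hr : 0 < r) (hθ : 0 < θ)
    (hθ' : θ ≤ 2 * Real.pi) (h : x = r * y * exp (θ * I)) : ccwAngle y x = θ := by
  have h1 : -(x / y) = r * (Complex.cos ((θ - Real.pi : ℝ) : ℂ) +
      Complex.sin ((θ - Real.pi : ℝ) : ℂ) * I) := by
    rw [← Complex.exp_mul_I, h]
    push_cast
    rw [sub_mul, Complex.exp_sub, Complex.exp_pi_mul_I]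
    field_simp
  unfold ccwAngle
  rw [h1, Complex.arg_mul_cos_add_sin_mul_I hr ⟨by linarith, by linarith⟩]
  ring

/-- With the range `(0, 2π]`, coinciding directions are a full turn apart. Hence a dart comes last
among the successors of its own reverse, and the corner around the end of a dangling edge has angle
2π. -/
theorem ccwAngle_self {y : ℂ} (hy : y ≠ 0) : ccwAngle y y = 2 * Real.pi := by
  refine ccwAngle_eq hy one_pos (by positivity) le_rfl ?_
  push_cast
  rw [Complex.exp_two_pi_mul_I]; simp

/-- Changing the reference direction subtracts angles; a full turn is added exactly when the
difference is not positive. The two cases are this lemma and `ccwAngle_of_le`. -/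
theorem ccwAngle_of_lt {y x c : ℂ} (hy : y ≠ 0) (hx : x ≠ 0) (hc : c ≠ 0)
    (h : ccwAngle y c < ccwAngle y x) : ccwAngle c x = ccwAngle y x - ccwAngle y c := by
  obtain ⟨r, hr, hrx⟩ := exists_eq_mul_exp_ccwAngle hy hx
  obtain ⟨s, hs, hsc⟩ := exists_eq_mul_exp_ccwAngle hy hc
  have h0 := ccwAngle_pos y c
  have h1 := ccwAngle_le y x
  refine ccwAngle_eq hc (div_pos hr hs) (by linarith) (by linarith) ?_
  generalize ccwAngle y x = α at *
  generalize ccwAngle y c = β at *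
  have hs' : (s : ℂ) ≠ 0 := by exact_mod_cast hs.ne'
  rw [hrx, hsc]
  push_cast
  rw [sub_mul, Complex.exp_sub]
  field_simp

theorem ccwAngle_of_le {y x c : ℂ} (hy : y ≠ 0) (hx : x ≠ 0) (hc : c ≠ 0)
    (h : ccwAngle y x ≤ ccwAngle y c) :
    ccwAngle c x = ccwAngle y x - ccwAngle y c + 2 * Real.pi := by
  obtain ⟨r, hr, hrx⟩ := exists_eq_mul_exp_ccwAngle hy hx
  obtain ⟨s, hs, hsc⟩ := exists_eq_mul_exp_ccwAngle hy hc
  have h0 := ccwAngle_pos y x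
  have h1 := ccwAngle_le y c
  refine ccwAngle_eq hc (div_pos hr hs) (by linarith) (by linarith) ?_
  generalize ccwAngle y x = α at *
  generalize ccwAngle y c = β at *
  have hs' : (s : ℂ) ≠ 0 := by exact_mod_cast hs.ne'
  rw [hrx, hsc]
  push_cast
  rw [add_mul, Complex.exp_add, Complex.exp_two_pi_mul_I, sub_mul, Complex.exp_sub]
  field_simp

theorem ccwAngle_eq_two_pi_iff {y x : ℂ} (hy : y ≠ 0) (hx : x ≠ 0) :
    ccwAngle y x = 2 * Real.pi ↔ ∃ r : ℝ, 0 < r ∧ x = r * y := by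
  constructor
  · intro h
    obtain ⟨r, hr, hrx⟩ := exists_eq_mul_exp_ccwAngle hy hx
    refine ⟨r, hr, ?_⟩
    rw [h] at hrx
    push_cast at hrx
    rwa [Complex.exp_two_pi_mul_I, mul_one] at hrx
  · rintro ⟨r, hr, h⟩
    refine ccwAngle_eq hy hr (by positivity) le_rfl ?_
    push_cast
    rw [Complex.exp_two_pi_mul_I, h, mul_one]

theorem ccwAngle_inj {y x x' : ℂ} (hy : y ≠ 0) (hx : x ≠ 0) (hx' : x' ≠ 0)
    (h : ccwAngle y x = ccwAngle y x') : ∃ r : ℝ, 0 < r ∧ x' = r * x := by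
  have := ccwAngle_of_le hy hx' hx h.ge
  rw [h, sub_self, zero_add] at this
  exact (ccwAngle_eq_two_pi_iff hx hx').1 this

/-- The half-angle function with the cut along the direction `c`. -/
def halfAngle (c v : ℂ) : ℂ := exp (I / 2 * ((ccwAngle c v - Real.pi : ℝ) : ℂ))

/-- The square does not see the branch, only the two unit vectors. This is the source of the
telescoping along cycles. -/
theorem halfAngle_sq {c v : ℂ} (hc : c ≠ 0) (hv : v ≠ 0) :
    halfAngle c v ^ 2 = - (v / ‖v‖) / (c / ‖c‖) := by
  obtain ⟨r, hr, h⟩ := exists_eq_mul_exp_ccwAngle hc hv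
  have h1 : halfAngle c v ^ 2 = - exp (ccwAngle c v * I) := by
    unfold halfAngle
    rw [← Complex.exp_nat_mul]
    push_cast
    rw [show (2 : ℂ) * (I / 2 * (ccwAngle c v - Real.pi)) = ccwAngle c v * I - Real.pi * I by ring,
      Complex.exp_sub, Complex.exp_pi_mul_I]
    ring
  have h2 : ‖v‖ = r * ‖c‖ := by
    conv_lhs => rw [h]
    rw [norm_mul, norm_mul, Complex.norm_exp_ofReal_mul_I, Complex.norm_real,
      Real.norm_of_nonneg hr.le, mul_one]
  have hr' : (r : ℂ) ≠ 0 := by exact_mod_cast hr.ne'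
  have hc' : (‖c‖ : ℂ) ≠ 0 := by exact_mod_cast norm_ne_zero_iff.2 hc
  rw [h1, h2]
  conv_rhs => rw [h]
  push_cast
  field_simp

open Classical in
/-- The half-angle functions along the sector from `y` counterclockwise to `x`: the sign is `-1`
if the cut is in the open sector or along its first side. -/
theorem halfAngle_div_halfAngle {y x c : ℂ} (hy : y ≠ 0) (hx : x ≠ 0) (hc : c ≠ 0) :
    halfAngle c y / halfAngle c x = exp (-(I / 2) * ccwAngle y x) *
      if ccwAngle y c < ccwAngle y x ∨ ccwAngle y c = 2 * Real.pi then -1 else 1 := by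
  -- Here α and β are the angles of `y` and `x` from the cut and γ is the sector. Crossing the cut
  -- loses 2π, whose half gives the sign.
  have key : ∀ α β γ : ℝ, ((β - α = γ → exp (I / 2 * ((α - Real.pi : ℝ) : ℂ)) /
      exp (I / 2 * ((β - Real.pi : ℝ) : ℂ)) = exp (-(I / 2) * γ)) ∧
      (β - α = γ - 2 * Real.pi → exp (I / 2 * ((α - Real.pi : ℝ) : ℂ)) /
      exp (I / 2 * ((β - Real.pi : ℝ) : ℂ)) = - exp (-(I / 2) * γ))) := by
    intro α β γ
    constructor
    · intro h
      rw [← Complex.exp_sub]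
      congr 1
      rw [← h]; push_cast; ring
    · intro h
      have h' : γ = β - α + 2 * Real.pi := by linarith
      rw [← Complex.exp_sub, h']
      push_cast
      rw [show -(I / 2) * ((β : ℂ) - α + 2 * Real.pi) = I / 2 * (α - Real.pi) -
        I / 2 * (β - Real.pi) - Real.pi * I by ring, Complex.exp_sub _ (Real.pi * I),
        Complex.exp_pi_mul_I]
      ring
  have hcy : ccwAngle y c < 2 * Real.pi → ccwAngle c y = 2 * Real.pi - ccwAngle y c := by
    intro h
    rw [← ccwAngle_self hy] at h ⊢
    exact ccwAngle_of_lt hy hy hc h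
  have hcy' : ccwAngle y c = 2 * Real.pi → ccwAngle c y = 2 * Real.pi := by
    intro h
    have := ccwAngle_of_le hy hy hc (by rw [ccwAngle_self hy, h])
    rw [this, ccwAngle_self hy, h]; ring
  unfold halfAngle
  have hle := ccwAngle_le y c
  by_cases h1 : ccwAngle y c < ccwAngle y x
  · rw [if_pos (Or.inl h1), mul_neg_one]
    apply (key _ _ _).2
    rw [ccwAngle_of_lt hy hx hc h1, hcy (h1.trans_le (ccwAngle_le _ _))]
    ring
  · rw [not_lt] at h1
    by_cases h2 : ccwAngle y c = 2 * Real.pi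
    · rw [if_pos (Or.inr h2), mul_neg_one]
      apply (key _ _ _).2
      rw [ccwAngle_of_le hy hx hc h1, hcy' h2, h2]; ring
    · rw [if_neg (by simp [h2, h1]), mul_one]
      apply (key _ _ _).1
      rw [ccwAngle_of_le hy hx hc h1, hcy (lt_of_le_of_ne hle h2)]; ring


theorem ccwAngle_add {y x c : ℂ} (hy : y ≠ 0) (hx : x ≠ 0) (hc : c ≠ 0)
    (h : ccwAngle y c + ccwAngle c x ≤ 2 * Real.pi) :
    ccwAngle y x = ccwAngle y c + ccwAngle c x := by
  obtain ⟨r, hr, hrx⟩ := exists_eq_mul_exp_ccwAngle hc hx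
  obtain ⟨s, hs, hsc⟩ := exists_eq_mul_exp_ccwAngle hy hc
  have h0 := ccwAngle_pos y c
  have h1 := ccwAngle_pos c x
  refine ccwAngle_eq hy (mul_pos hr hs) (by linarith) h ?_
  generalize ccwAngle y c = α at *
  generalize ccwAngle c x = β at *
  rw [hrx, hsc]
  push_cast
  rw [add_mul, Complex.exp_add]
  ring

/-! ### Directions compared with the upward vertical -/

theorem ccwAngle_lt_pi_iff {y x : ℂ} : ccwAngle y x < Real.pi ↔ 0 < (x / y).im := by
  unfold ccwAngle
  rw [add_lt_iff_neg_right, Complex.arg_neg_iff, Complex.neg_im, neg_lt_zero]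

theorem im_div_pos_iff {y x : ℂ} (hy : y ≠ 0) : 0 < (x / y).im ↔ 0 < y.re * x.im - y.im * x.re := by
  have : 0 < Complex.normSq y := Complex.normSq_pos.2 hy
  rw [Complex.div_im, ← sub_div, div_pos_iff_of_pos_right this]
  constructor <;> intro h <;> linarith

theorem ccwAngle_lt_pi_iff' {y x : ℂ} (hy : y ≠ 0) :
    ccwAngle y x < Real.pi ↔ 0 < y.re * x.im - y.im * x.re :=
  ccwAngle_lt_pi_iff.trans (im_div_pos_iff hy)

theorem ccwAngle_I_lt_pi_iff {y : ℂ} (hy : y ≠ 0) : ccwAngle y I < Real.pi ↔ 0 < y.re := by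
  rw [ccwAngle_lt_pi_iff' hy]; simp

theorem ccwAngle_I_left_lt_pi_iff {x : ℂ} : ccwAngle I x < Real.pi ↔ x.re < 0 := by
  rw [ccwAngle_lt_pi_iff' I_ne_zero]; simp

theorem ccwAngle_I_le_pi {w : ℂ} (h : 0 < w.re ∨ w.re = 0 ∧ w.im < 0) :
    ccwAngle w I ≤ Real.pi := by
  rcases h with h | ⟨h, h'⟩
  · exact ((ccwAngle_I_lt_pi_iff (by rintro rfl; simp at h)).2 h).le
  · have : w = (w.im : ℂ) * I := by apply Complex.ext <;> simp [h]
    have hw : w ≠ 0 := by rintro rfl; simp at h'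
    refine (ccwAngle_eq (r := -(w.im)⁻¹) hw ?_ Real.pi_pos (by linarith [Real.pi_pos]) ?_).le
    · have := inv_lt_zero.2 h'; linarith
    · rw [Complex.exp_pi_mul_I]
      have h3 : (w.im : ℂ) ≠ 0 := by exact_mod_cast h'.ne
      conv_rhs => rw [this]
      push_cast
      field_simp
      simp [h3]

theorem ccwAngle_I_left_le_pi {w : ℂ} (h : w.re < 0 ∨ w.re = 0 ∧ w.im < 0) :
    ccwAngle I w ≤ Real.pi := by
  rcases h with h | ⟨h, h'⟩
  · exact (ccwAngle_I_left_lt_pi_iff.2 h).le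
  · have : w = (w.im : ℂ) * I := by apply Complex.ext <;> simp [h]
    refine (ccwAngle_eq (r := -w.im) I_ne_zero (by linarith) Real.pi_pos
      (by linarith [Real.pi_pos]) ?_).le
    rw [Complex.exp_pi_mul_I]
    conv_lhs => rw [this]
    push_cast
    ring

/-- Points of the convex cone spanned by `y` and the upward vertical. -/
theorem ccwAngle_lt_of_mem_cone_right {y : ℂ} (hy : 0 < y.re) {t s : ℝ} (ht : 0 < t) (hs : 0 < s) :
    ccwAngle y (t * y + s * I) < ccwAngle y I := by
  have hy0 : y ≠ 0 := by rintro rfl; simp at hy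
  set w : ℂ := t * y + s * I with hw
  have hwre : w.re = t * y.re := by simp [hw]
  have hwim : w.im = t * y.im + s := by simp [hw]
  have hwpos : 0 < w.re := by rw [hwre]; positivity
  have hw0 : w ≠ 0 := by intro h; simp [h] at hwpos
  by_contra! h
  have h1 := ccwAngle_of_le hy0 I_ne_zero hw0 h
  have h2 := (ccwAngle_I_lt_pi_iff hw0).2 hwpos
  have h3 : ccwAngle y w < Real.pi := by
    rw [ccwAngle_lt_pi_iff' hy0, hwre, hwim]
    have : 0 < s * y.re := by positivity
    linarith
  have := ccwAngle_pos y I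
  linarith

theorem ccwAngle_lt_of_mem_cone_left {x : ℂ} (hx : x.re < 0) {t s : ℝ} (ht : 0 < t) (hs : 0 < s) :
    ccwAngle I (t * x + s * I) < ccwAngle I x := by
  have hx0 : x ≠ 0 := by rintro rfl; simp at hx
  set w : ℂ := t * x + s * I with hw
  have hwre : w.re = t * x.re := by simp [hw]
  have hwim : w.im = t * x.im + s := by simp [hw]
  have hwpos : w.re < 0 := by rw [hwre]; exact mul_neg_of_pos_of_neg ht hx
  have hw0 : w ≠ 0 := by intro h; simp [h] at hwpos
  by_contra! h
  have h1 := ccwAngle_of_le I_ne_zero hx0 hw0 h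
  have h2 := ccwAngle_I_left_lt_pi_iff.2 hwpos
  have h3 : ccwAngle w x < Real.pi := by
    rw [ccwAngle_lt_pi_iff' hw0, hwre, hwim]
    have := mul_neg_of_pos_of_neg hs hx
    linarith
  have := ccwAngle_pos I x
  linarith

/-- Turning counterclockwise from a leftward `y` to the upward vertical sweeps the downward vertical
and the whole right half-plane. A corner that opens upward past such a side therefore does not
obstruct the vertical below its vertex. -/
theorem ccwAngle_lt_of_re_neg {y w : ℂ} (hy : y.re < 0) (hw : 0 < w.re ∨ w.re = 0 ∧ w.im < 0) :
    ccwAngle y w < ccwAngle y I := by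
  have hy0 : y ≠ 0 := by rintro rfl; simp at hy
  have hw0 : w ≠ 0 := by rintro rfl; simp at hw
  by_contra! h
  have h1 := ccwAngle_of_le hy0 I_ne_zero hw0 h
  have h2 := ccwAngle_I_le_pi hw
  have h3 : Real.pi ≤ ccwAngle y I := by
    rw [← not_lt, ccwAngle_I_lt_pi_iff hy0]; linarith
  have h4 := ccwAngle_le y w
  have h5 : ccwAngle y I = Real.pi → False := by
    intro h5
    obtain ⟨r, hr, h6⟩ := exists_eq_mul_exp_ccwAngle hy0 I_ne_zero
    rw [h5, Complex.exp_pi_mul_I] at h6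
    have := congrArg Complex.re h6
    simp at this
    rcases this with h7 | h7 <;> linarith
  rcases h3.lt_or_eq with h3 | h3
  · linarith
  · exact h5 h3.symm

theorem ccwAngle_left_lt_of_re_pos {x w : ℂ} (hx : 0 < x.re) (hw : w.re < 0 ∨ w.re = 0 ∧ w.im < 0) :
    ccwAngle I w < ccwAngle I x := by
  have hx0 : x ≠ 0 := by rintro rfl; simp at hx
  have h2 := ccwAngle_I_left_le_pi hw
  have h3 : Real.pi ≤ ccwAngle I x := by
    rw [← not_lt, ccwAngle_I_left_lt_pi_iff]; linarith
  rcases h3.lt_or_eq with h3 | h3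
  · linarith
  · exfalso
    obtain ⟨r, hr, h6⟩ := exists_eq_mul_exp_ccwAngle I_ne_zero hx0
    rw [← h3, Complex.exp_pi_mul_I] at h6
    have := congrArg Complex.re h6
    simp at this
    linarith

/-! ### Planar regions bounded by straight edges -/

/-- A straight-line drawing in the plane, possibly periodic, together with one component `region`
of its complement. The vertices of the drawing over `v : V` are the points of `lift v`; a dart
`d : D` starts at every point over `src d`, and has displacement `vec d`. No edge is vertical, and
different vertices are not on the same vertical line. -/
structure PlanarRegion (V D : Type*) where
  /-- the initial vertex of a dart -/
  src : D → V
  /-- the opposite dart -/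
  rev : D → D
  /-- the displacement of a dart -/
  vec : D → ℂ
  /-- the points over a vertex -/
  lift : V → Set ℂ
  /-- a component of the complement -/
  region : Set ℂ
  rev_rev : ∀ d, rev (rev d) = d
  vec_rev : ∀ d, vec (rev d) = -vec d
  vec_re_ne : ∀ d, (vec d).re ≠ 0
  exists_dart : ∀ v, ∃ d, src d = v
  lift_dst : ∀ d, ∀ p ∈ lift (src d), p + vec d ∈ lift (src (rev d))
  lift_src : ∀ d, ∀ p ∈ lift (src (rev d)), p - vec d ∈ lift (src d)
  lift_inj : ∀ v w p, p ∈ lift v → p ∈ lift w → v = w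
  lift_nonempty : ∀ v, (lift v).Nonempty
  re_inj : ∀ v w, ∀ p ∈ lift v, ∀ q ∈ lift w, p.re = q.re → p = q
  -- Local finiteness: an edge that comes close to `p` passes through `p`.
  exists_ball : ∀ p : ℂ, ∃ ε > 0, ∀ z ∈ Metric.ball p ε,
    (∃ d, ∃ b ∈ lift (src d), ∃ t ∈ Icc (0 : ℝ) 1, z = b + t * vec d) →
      ∃ d, ∃ b ∈ lift (src d), ∃ t ∈ Icc (0 : ℝ) 1, ∃ t₀ ∈ Icc (0 : ℝ) 1,
        z = b + t * vec d ∧ p = b + t₀ * vec d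
  edge_ne_vertex : ∀ d, ∀ b ∈ lift (src d), ∀ t ∈ Ioo (0 : ℝ) 1, ∀ v, b + t * vec d ∉ lift v
  edge_inj : ∀ d d', ∀ b ∈ lift (src d), ∀ b' ∈ lift (src d'), ∀ t ∈ Ioo (0 : ℝ) 1,
    ∀ t' ∈ Ioo (0 : ℝ) 1, b + t * vec d = b' + t' * vec d' →
      (d' = d ∧ b' = b) ∨ (d' = rev d ∧ b' = b + vec d)
  nonempty : region.Nonempty
  preconnected : IsPreconnected region
  region_disjoint : ∀ d, ∀ b ∈ lift (src d), ∀ t ∈ Icc (0 : ℝ) 1, b + t * vec d ∉ region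
  maximal : ∀ C : Set ℂ, IsPreconnected C →
    (∀ d, ∀ b ∈ lift (src d), ∀ t ∈ Icc (0 : ℝ) 1, b + t * vec d ∉ C) →
      (C ∩ region).Nonempty → C ⊆ region
  -- The only substitute for boundedness that the sweep needs: going down, one leaves the region.
  exists_notMem_below : ∀ z ∈ region, ∃ s : ℝ, 0 < s ∧ z - s * I ∉ region
  lift_unique : ∀ v, ∀ b ∈ lift v, ∀ b' ∈ lift v, ∀ z ∈ region, z + (b' - b) ∈ region → b = b'
  -- The form in which simple connectivity is used.
  exists_angle : ∀ p ∉ region, ∃ A : ℂ → ℝ, ContinuousOn A region ∧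
    ∀ z ∈ region, z - p = ‖z - p‖ * exp (A z * I)

namespace PlanarRegion

variable {V D : Type*} (R : PlanarRegion V D)

/-- The points of the drawing. -/
def graph : Set ℂ := {z | ∃ d, ∃ b ∈ R.lift (R.src d), ∃ t ∈ Icc (0 : ℝ) 1, z = b + t * R.vec d}

variable {R}

theorem vec_ne_zero (d : D) : R.vec d ≠ 0 := fun h => R.vec_re_ne d (by simp [h])

theorem region_disjoint_graph {z : ℂ} (hz : z ∈ R.region) : z ∉ R.graph := by
  rintro ⟨d, b, hb, t, ht, rfl⟩
  exact R.region_disjoint d b hb t ht hz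

theorem subset_region {C : Set ℂ} (hC : IsPreconnected C) (h : ∀ z ∈ C, z ∉ R.graph)
    (hne : (C ∩ R.region).Nonempty) : C ⊆ R.region :=
  R.maximal C hC (fun d b hb t ht hz => h _ hz ⟨d, b, hb, t, ht, rfl⟩) hne

theorem mem_graph_of_mem_lift {v : V} {p : ℂ} (hp : p ∈ R.lift v) : p ∈ R.graph := by
  obtain ⟨d, rfl⟩ := R.exists_dart v
  exact ⟨d, p, hp, 0, by simp, by simp⟩

theorem exists_ball_disjoint_graph {p : ℂ} (hp : p ∉ R.graph) :
    ∃ ε > 0, ∀ z ∈ Metric.ball p ε, z ∉ R.graph := by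
  obtain ⟨ε, hε, h⟩ := R.exists_ball p
  refine ⟨ε, hε, fun z hz hzg => ?_⟩
  obtain ⟨d, b, hb, t, ht, t₀, ht₀, -, h₀⟩ := h z hz hzg
  exact hp ⟨d, b, hb, t₀, ht₀, h₀⟩

theorem isOpen_region : IsOpen R.region := by
  rw [Metric.isOpen_iff]
  intro p hp
  obtain ⟨ε, hε, h⟩ := exists_ball_disjoint_graph (region_disjoint_graph hp)
  exact ⟨ε, hε, subset_region (convex_ball p ε).isPreconnected h
    ⟨p, Metric.mem_ball_self hε, hp⟩⟩

/-- Any edge near an interior point of `d` passes through that point, hence is `d` itself or its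
reverse. -/
theorem exists_ball_edge {d : D} {b : ℂ} (hb : b ∈ R.lift (R.src d)) {τ : ℝ}
    (hτ : τ ∈ Ioo (0 : ℝ) 1) : ∃ ε > 0, ∀ z ∈ Metric.ball (b + τ * R.vec d) ε, z ∈ R.graph →
      ∃ t : ℝ, z = b + t * R.vec d := by
  obtain ⟨ε, hε, h⟩ := R.exists_ball (b + τ * R.vec d)
  refine ⟨ε, hε, fun z hz hzg => ?_⟩
  obtain ⟨d', b', hb', t, ht, t₀, ht₀, rfl, h₀⟩ := h z hz hzg
  have ht0 : t₀ ≠ 0 := by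
    rintro rfl
    refine R.edge_ne_vertex d b hb τ hτ (R.src d') ?_
    rw [h₀]; simpa using hb'
  have ht1 : t₀ ≠ 1 := by
    rintro rfl
    refine R.edge_ne_vertex d b hb τ hτ (R.src (R.rev d')) ?_
    rw [h₀]; simpa using R.lift_dst d' b' hb'
  rcases R.edge_inj d d' b hb b' hb' τ hτ t₀
    ⟨lt_of_le_of_ne ht₀.1 ht0.symm, lt_of_le_of_ne ht₀.2 ht1⟩ h₀ with ⟨rfl, rfl⟩ | ⟨rfl, rfl⟩
  · exact ⟨t, rfl⟩
  · refine ⟨1 - t, ?_⟩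
    rw [R.vec_rev]; push_cast; ring

theorem exists_ball_vertex {v : V} {p : ℂ} (hp : p ∈ R.lift v) : ∃ ε > 0,
    ∀ z ∈ Metric.ball p ε, z ∈ R.graph → z ≠ p →
      ∃ d, R.src d = v ∧ ∃ t : ℝ, 0 < t ∧ z = p + t * R.vec d := by
  obtain ⟨ε, hε, h⟩ := R.exists_ball p
  refine ⟨ε, hε, fun z hz hzg hzp => ?_⟩
  obtain ⟨d, b, hb, t, ht, t₀, ht₀, rfl, h₀⟩ := h z hz hzg
  by_cases ht0 : t₀ = 0
  · subst ht0
    have hpb : p = b := by simpa using h₀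
    subst hpb
    refine ⟨d, R.lift_inj _ _ p hb hp, t, lt_of_le_of_ne ht.1 ?_, rfl⟩
    rintro rfl; simp at hzp
  by_cases ht1 : t₀ = 1
  · subst ht1
    have hpb : p = b + R.vec d := by simpa using h₀
    refine ⟨R.rev d, R.lift_inj _ _ p (hpb ▸ R.lift_dst d b hb) hp, 1 - t, ?_, ?_⟩
    · rcases ht.2.lt_or_eq with h1 | h1
      · linarith
      · exfalso; apply hzp; rw [hpb, h1]; simp
    · rw [R.vec_rev, hpb]; push_cast; ring
  · exact absurd (h₀ ▸ hp) (R.edge_ne_vertex d b hb t₀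
      ⟨lt_of_le_of_ne ht₀.1 (Ne.symm ht0), lt_of_le_of_ne ht₀.2 ht1⟩ v)

/-- Two darts from the same vertex in the same direction are equal. -/
theorem eq_of_vec_eq {d d' : D} (h : R.src d = R.src d') {r : ℝ} (hr : 0 < r)
    (hv : R.vec d' = r * R.vec d) : d = d' := by
  obtain ⟨p, hp⟩ := R.lift_nonempty (R.src d)
  have hr' : (r : ℂ) ≠ 0 := by exact_mod_cast hr.ne'
  -- The parameters r / (2(1 + r)) and 1 / (2(1 + r)) give the same point on both darts and lie in
  -- (0, 1) for every r > 0.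
  have key : (p : ℂ) + ((r / (2 * (1 + r)) : ℝ) : ℂ) * R.vec d =
      p + ((1 / (2 * (1 + r)) : ℝ) : ℂ) * R.vec d' := by
    rw [hv]; push_cast; ring
  have h1 : r / (2 * (1 + r)) < 1 := by rw [div_lt_one (by positivity)]; linarith
  have h2 : 1 / (2 * (1 + r)) < 1 := by rw [div_lt_one (by positivity)]; linarith
  rcases R.edge_inj d d' p hp p (h ▸ hp) _ ⟨by positivity, h1⟩ _ ⟨by positivity, h2⟩ key with
    ⟨h3, -⟩ | ⟨-, h3⟩
  · exact h3.symm
  · exact absurd (by simpa using h3) (vec_ne_zero (R := R) d)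

/-! ### Sides -/

/-- The open half-plane to the left of a dart with initial point `b`. -/
def leftHalf (R : PlanarRegion V D) (d : D) (b : ℂ) : Set ℂ := {z | 0 < ((z - b) / R.vec d).im}

theorem convex_leftHalf (d : D) (b : ℂ) : Convex ℝ (R.leftHalf d b) := by
  intro z hz w hw s t hs ht hst
  have : (s • z + t • w - b) / R.vec d = s * ((z - b) / R.vec d) + t * ((w - b) / R.vec d) := by
    have h : (s : ℂ) + t = 1 := by exact_mod_cast hst
    simp only [Complex.real_smul]
    rw [mul_div_assoc', mul_div_assoc', ← add_div]
    congr 1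
    linear_combination b * h
  simp only [leftHalf, mem_ofPred_eq] at hz hw ⊢
  rw [this]
  simp only [Complex.add_im, Complex.im_ofReal_mul]
  rcases hs.lt_or_eq with hs | rfl
  · have := mul_pos hs hz
    have := mul_nonneg ht hw.le
    linarith
  · have : t = 1 := by linarith
    subst this; simpa using hw

theorem add_mul_mem_leftHalf (d : D) (b w : ℂ) (hw : 0 < w.im) :
    b + w * R.vec d ∈ R.leftHalf d b := by
  simpa [leftHalf, vec_ne_zero d] using hw

/-- The dart `d` from `b` has the region on its left. -/
def IsSide (R : PlanarRegion V D) (d : D) (b : ℂ) : Prop :=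
  b ∈ R.lift (R.src d) ∧ ∀ τ ∈ Ioo (0 : ℝ) 1,
    ∀ᶠ z in 𝓝[R.leftHalf d b] (b + τ * R.vec d), z ∈ R.region

/-- A small half-disc to the left of an edge misses the drawing and is convex, so by maximality the
region contains it or avoids it. -/
theorem leftGerm_dichotomy {d : D} {b : ℂ} (hb : b ∈ R.lift (R.src d)) {τ : ℝ}
    (hτ : τ ∈ Ioo (0 : ℝ) 1) :
    (∀ᶠ z in 𝓝[R.leftHalf d b] (b + τ * R.vec d), z ∈ R.region) ∨
    (∀ᶠ z in 𝓝[R.leftHalf d b] (b + τ * R.vec d), z ∉ R.region) := by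
  obtain ⟨ε, hε, h⟩ := exists_ball_edge hb hτ
  set C := Metric.ball (b + τ * R.vec d) ε ∩ R.leftHalf d b
  have hC : C ∈ 𝓝[R.leftHalf d b] (b + τ * R.vec d) := by
    rw [show C = R.leftHalf d b ∩ Metric.ball (b + τ * R.vec d) ε from inter_comm _ _]
    exact inter_mem_nhdsWithin _ (Metric.ball_mem_nhds _ hε)
  have hpre : IsPreconnected C := ((convex_ball _ _).inter (convex_leftHalf d b)).isPreconnected
  have hdis : ∀ z ∈ C, z ∉ R.graph := by
    intro z hz hzg
    obtain ⟨t, rfl⟩ := h z hz.1 hzg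
    have := hz.2
    simp [leftHalf, vec_ne_zero d] at this
  by_cases hne : (C ∩ R.region).Nonempty
  · exact Or.inl (mem_of_superset hC (subset_region hpre hdis hne))
  · refine Or.inr (mem_of_superset hC fun z hz hz' => hne ⟨z, hz, hz'⟩)

/-- The two alternatives of `leftGerm_dichotomy` are open, disjoint conditions on the parameter, and
the open edge is connected: touching the region from the left at one point suffices. -/
theorem isSide_of_frequently {d : D} {b : ℂ} (hb : b ∈ R.lift (R.src d)) {τ : ℝ}
    (hτ : τ ∈ Ioo (0 : ℝ) 1)
    (h : ∃ᶠ z in 𝓝[R.leftHalf d b] (b + τ * R.vec d), z ∈ R.region) : R.IsSide d b := by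
  have hopen : ∀ q : ℂ → Prop,
      IsOpen {τ : ℝ | ∀ᶠ z in 𝓝[R.leftHalf d b] (b + τ * R.vec d), q z} := by
    intro q
    rw [isOpen_iff_mem_nhds]
    intro t ht
    have hc : ContinuousAt (fun t : ℝ => b + t * R.vec d) t := by fun_prop
    simp only [mem_ofPred_eq, eventually_nhdsWithin_iff] at ht
    exact mem_of_superset (hc.eventually (eventually_eventually_nhds.2 ht))
      fun t' ht' => eventually_nhdsWithin_iff.2 ht'
  refine ⟨hb, fun t ht => ?_⟩
  refine isPreconnected_Ioo.subset_left_of_subset_union (hopen fun z => z ∈ R.region)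
    (hopen fun z => z ∉ R.region) ?_ (fun t ht => leftGerm_dichotomy hb ht)
    ⟨τ, hτ, ((leftGerm_dichotomy hb hτ).resolve_right fun h' => ?_)⟩ ht
  · rw [Set.disjoint_left]
    intro t h1 h2
    simp only [mem_ofPred_eq] at h1 h2
    have hne : (𝓝[R.leftHalf d b] (b + t * R.vec d)).NeBot := by
      have hc : Tendsto (fun s : ℝ => b + (t + s * I) * R.vec d) (𝓝[>] 0)
          (𝓝[R.leftHalf d b] (b + t * R.vec d)) := by
        refine tendsto_nhdsWithin_of_tendsto_nhds_of_eventually_within _ ?_ ?_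
        · refine Tendsto.mono_left ?_ nhdsWithin_le_nhds
          exact Continuous.tendsto' (by fun_prop) _ _ (by simp)
        · filter_upwards [self_mem_nhdsWithin] with s hs
          exact add_mul_mem_leftHalf d b _ (by simpa using hs)
      exact hc.neBot
    obtain ⟨z, hz1, hz2⟩ := (h1.and h2).exists
    exact hz2 hz1
  · exact h h'

end PlanarRegion


/-! ### Corners and the successor of a side -/

theorem isPreconnected_sector {y : ℂ} (hy : y ≠ 0) (p : ℂ) (ε : ℝ) {φ : ℝ}
    (hφ : φ ≤ 2 * Real.pi) :
    IsPreconnected (Metric.ball p ε ∩ {z | z ≠ p ∧ ccwAngle y (z - p) < φ}) := by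
  have hy' : 0 < ‖y‖ := norm_pos_iff.2 hy
  have himg : Metric.ball p ε ∩ {z | z ≠ p ∧ ccwAngle y (z - p) < φ} =
      (fun x : ℝ × ℝ => p + x.1 * y * exp (x.2 * I)) '' (Ioo 0 (ε / ‖y‖) ×ˢ Ioo 0 φ) := by
    ext z
    constructor
    · rintro ⟨hz, hzp, hz'⟩
      obtain ⟨r, hr, h⟩ := exists_eq_mul_exp_ccwAngle hy (sub_ne_zero.2 hzp)
      refine ⟨(r, ccwAngle y (z - p)), ⟨⟨hr, ?_⟩, ccwAngle_pos _ _, hz'⟩, ?_⟩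
      · rw [lt_div_iff₀ hy']
        rw [Metric.mem_ball, dist_eq_norm, h, norm_mul, norm_mul, Complex.norm_exp_ofReal_mul_I,
          Complex.norm_real, Real.norm_of_nonneg hr.le, mul_one] at hz
        exact hz
      · simp only [← h]; ring
    · rintro ⟨⟨r, θ⟩, ⟨⟨hr, hr'⟩, hθ, hθ'⟩, rfl⟩
      simp only at hr hr' hθ hθ' ⊢
      have hr0 : (r : ℂ) ≠ 0 := by exact_mod_cast hr.ne'
      refine ⟨?_, ?_, ?_⟩
      · rw [Metric.mem_ball, dist_eq_norm, add_sub_cancel_left, norm_mul, norm_mul,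
          Complex.norm_exp_ofReal_mul_I, Complex.norm_real, Real.norm_of_nonneg hr.le, mul_one]
        rwa [lt_div_iff₀ hy'] at hr'
      · intro h
        have : (r : ℂ) * y * exp (θ * I) = 0 := by simpa using h
        simp [hr0, hy] at this
      · rwa [add_sub_cancel_left, ccwAngle_eq hy hr hθ (by linarith) rfl]
  rw [himg]
  refine (isPreconnected_Ioo.prod isPreconnected_Ioo).image _ (Continuous.continuousOn ?_)
  fun_prop

namespace PlanarRegion

variable {V D : Type*} {R : PlanarRegion V D}

/-- The dart `y` follows `d` on the boundary of the face to the left of `d`. -/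
def IsNext (R : PlanarRegion V D) (d y : D) : Prop :=
  R.src y = R.src (R.rev d) ∧ ∀ w, R.src w = R.src (R.rev d) →
    ccwAngle (R.vec y) (R.vec (R.rev d)) ≤ ccwAngle (R.vec w) (R.vec (R.rev d))

/-- A dart strictly inside the corner would be closer to `rev d` than `y` is: corners are empty. -/
theorem IsNext.le_ccwAngle {d y : D} (h : R.IsNext d y) {w : D} (hw : R.src w = R.src (R.rev d)) :
    ccwAngle (R.vec y) (R.vec (R.rev d)) ≤ ccwAngle (R.vec y) (R.vec w) := by
  by_contra! hlt
  have h1 := ccwAngle_of_lt (vec_ne_zero y) (vec_ne_zero _) (vec_ne_zero w) hlt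
  have h2 := h.2 w hw
  have h3 := ccwAngle_pos (R.vec y) (R.vec w)
  linarith

theorem IsNext.left_unique {d d' y : D} (h : R.IsNext d y) (h' : R.IsNext d' y) : d = d' := by
  have hs : R.src (R.rev d) = R.src (R.rev d') := h.1.symm.trans h'.1
  have h1 := h.le_ccwAngle (w := R.rev d') hs.symm
  have h2 := h'.le_ccwAngle (w := R.rev d) hs
  obtain ⟨r, hr, h3⟩ := ccwAngle_inj (vec_ne_zero y) (vec_ne_zero _) (vec_ne_zero _)
    (le_antisymm h1 h2)
  have := eq_of_vec_eq hs hr h3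
  rw [← R.rev_rev d, this, R.rev_rev]

/-- The corner between the end of `d` and its successor `y`, at the vertex `p`. -/
def sector (R : PlanarRegion V D) (d y : D) (p : ℂ) : Set ℂ :=
  {z | z ≠ p ∧ ccwAngle (R.vec y) (z - p) < ccwAngle (R.vec y) (R.vec (R.rev d))}

/-- Since the corner contains no dart, a small circular sector at the vertex is connected and misses
the drawing. -/
theorem sectorGerm_dichotomy {d y : D} (h : R.IsNext d y) {p : ℂ}
    (hp : p ∈ R.lift (R.src (R.rev d))) :
    (∀ᶠ z in 𝓝[R.sector d y p] p, z ∈ R.region) ∨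
    (∀ᶠ z in 𝓝[R.sector d y p] p, z ∉ R.region) := by
  obtain ⟨ε, hε, hε'⟩ := exists_ball_vertex hp
  set C := Metric.ball p ε ∩ R.sector d y p with hCdef
  have hC : C ∈ 𝓝[R.sector d y p] p := by
    rw [hCdef, inter_comm]
    exact inter_mem_nhdsWithin _ (Metric.ball_mem_nhds _ hε)
  have hpre : IsPreconnected C := isPreconnected_sector (vec_ne_zero y) p ε (ccwAngle_le _ _)
  have hdis : ∀ z ∈ C, z ∉ R.graph := by
    rintro z ⟨hz, hzp, hz'⟩ hzg
    obtain ⟨w, hw, t, ht, rfl⟩ := hε' z hz hzg hzp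
    have h1 := h.le_ccwAngle hw
    rw [add_sub_cancel_left] at hz'
    have ht' : (t : ℂ) ≠ 0 := by exact_mod_cast ht.ne'
    obtain ⟨r, hr, h2⟩ := exists_eq_mul_exp_ccwAngle (vec_ne_zero y) (vec_ne_zero (R := R) w)
    have h3 : ccwAngle (R.vec y) (t * R.vec w) = ccwAngle (R.vec y) (R.vec w) := by
      refine ccwAngle_eq (vec_ne_zero y) (mul_pos ht hr) (ccwAngle_pos _ _) (ccwAngle_le _ _) ?_
      push_cast
      linear_combination (t : ℂ) * h2
    linarith
  by_cases hne : (C ∩ R.region).Nonempty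
  · exact Or.inl (mem_of_superset hC (subset_region hpre hdis hne))
  · exact Or.inr (mem_of_superset hC fun z hz hz' => hne ⟨z, hz, hz'⟩)

/-- The region fills the corner between `d` and `y` at `p`. -/
def HasCorner (R : PlanarRegion V D) (d y : D) (p : ℂ) : Prop :=
  ∀ᶠ z in 𝓝[R.sector d y p] p, z ∈ R.region

/-- Near the end of `d`, points slightly to the left of `d`. -/
theorem tendsto_rotate_end (d : D) (p : ℂ) {ρ : ℝ} (hρ : 0 < ρ) :
    Tendsto (fun δ : ℝ => p + ρ * R.vec (R.rev d) * exp ((-δ : ℝ) * I)) (𝓝[>] 0)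
      (𝓝[R.leftHalf d (p - R.vec d)] (p - R.vec d + (1 - ρ : ℝ) * R.vec d)) := by
  refine tendsto_nhdsWithin_of_tendsto_nhds_of_eventually_within _ ?_ ?_
  · refine Tendsto.mono_left ?_ nhdsWithin_le_nhds
    refine Continuous.tendsto' (by fun_prop) _ _ ?_
    rw [R.vec_rev]; push_cast; simp; ring
  · filter_upwards [Ioo_mem_nhdsGT Real.pi_pos] with δ hδ
    have : p + ρ * R.vec (R.rev d) * exp ((-δ : ℝ) * I) =
        p - R.vec d + (1 - ρ * exp ((-δ : ℝ) * I)) * R.vec d := by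
      rw [R.vec_rev]; ring
    rw [this]
    apply add_mul_mem_leftHalf
    rw [Complex.sub_im, Complex.im_ofReal_mul, Complex.exp_ofReal_mul_I_im, Real.sin_neg]
    have := mul_pos hρ (Real.sin_pos_of_pos_of_lt_pi hδ.1 hδ.2)
    simp; linarith

theorem eventually_rotate_end_mem_sector {d y : D} (p : ℂ) {ρ : ℝ} (hρ : 0 < ρ) :
    ∀ᶠ δ : ℝ in 𝓝[>] 0, p + ρ * R.vec (R.rev d) * exp ((-δ : ℝ) * I) ∈ R.sector d y p := by
  filter_upwards [Ioo_mem_nhdsGT (ccwAngle_pos (R.vec y) (R.vec (R.rev d)))] with δ hδ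
  have hρ' : (ρ : ℂ) ≠ 0 := by exact_mod_cast hρ.ne'
  refine ⟨by simp [hρ', vec_ne_zero], ?_⟩
  obtain ⟨r, hr, h2⟩ := exists_eq_mul_exp_ccwAngle (vec_ne_zero y) (vec_ne_zero (R := R) (R.rev d))
  have h1 := ccwAngle_le (R.vec y) (R.vec (R.rev d))
  have h3 : ccwAngle (R.vec y) (ρ * R.vec (R.rev d) * exp ((-δ : ℝ) * I)) =
      ccwAngle (R.vec y) (R.vec (R.rev d)) - δ := by
    refine ccwAngle_eq (vec_ne_zero y) (mul_pos hρ hr) (by linarith [hδ.2]) (by linarith [hδ.1]) ?_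
    generalize ccwAngle (R.vec y) (R.vec (R.rev d)) = α at *
    rw [h2]
    push_cast
    rw [neg_mul, Complex.exp_neg, sub_mul, Complex.exp_sub]
    ring
  rw [add_sub_cancel_left, h3]
  linarith [hδ.1]

theorem tendsto_rotate_start (y : D) (p : ℂ) {ρ : ℝ} (hρ : 0 < ρ) :
    Tendsto (fun δ : ℝ => p + ρ * R.vec y * exp (δ * I)) (𝓝[>] 0)
      (𝓝[R.leftHalf y p] (p + ρ * R.vec y)) := by
  refine tendsto_nhdsWithin_of_tendsto_nhds_of_eventually_within _ ?_ ?_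
  · refine Tendsto.mono_left ?_ nhdsWithin_le_nhds
    exact Continuous.tendsto' (by fun_prop) _ _ (by simp)
  · filter_upwards [Ioo_mem_nhdsGT Real.pi_pos] with δ hδ
    have : p + ρ * R.vec y * exp (δ * I) = p + (ρ * exp (δ * I)) * R.vec y := by ring
    rw [this]
    apply add_mul_mem_leftHalf
    rw [Complex.im_ofReal_mul, Complex.exp_ofReal_mul_I_im]
    exact mul_pos hρ (Real.sin_pos_of_pos_of_lt_pi hδ.1 hδ.2)

theorem eventually_rotate_start_mem_sector {d y : D} (p : ℂ) {ρ : ℝ} (hρ : 0 < ρ) :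
    ∀ᶠ δ : ℝ in 𝓝[>] 0, p + ρ * R.vec y * exp (δ * I) ∈ R.sector d y p := by
  filter_upwards [Ioo_mem_nhdsGT (ccwAngle_pos (R.vec y) (R.vec (R.rev d)))] with δ hδ
  have hρ' : (ρ : ℂ) ≠ 0 := by exact_mod_cast hρ.ne'
  refine ⟨by simp [hρ', vec_ne_zero], ?_⟩
  have h1 := ccwAngle_le (R.vec y) (R.vec (R.rev d))
  rw [add_sub_cancel_left, ccwAngle_eq (vec_ne_zero y) hρ hδ.1 (by linarith [hδ.2]) rfl]
  exact hδ.2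

theorem norm_mul_vec_mul_exp {ρ : ℝ} (hρ : 0 < ρ) (v : ℂ) (δ : ℝ) :
    ‖(ρ : ℂ) * v * exp (δ * I)‖ = ρ * ‖v‖ := by
  rw [norm_mul, norm_mul, Complex.norm_exp_ofReal_mul_I, Complex.norm_real,
    Real.norm_of_nonneg hρ.le, mul_one]

theorem exists_small (ε : ℝ) (hε : 0 < ε) (v : ℂ) : ∃ ρ : ℝ, 0 < ρ ∧ ρ < 1 ∧ ρ * ‖v‖ < ε := by
  refine ⟨min (1 / 2) (ε / (‖v‖ + 1) / 2), by positivity, ?_, ?_⟩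
  · exact (min_le_left _ _).trans_lt (by norm_num)
  · have h1 : 0 ≤ ‖v‖ := norm_nonneg v
    calc _ ≤ ε / (‖v‖ + 1) / 2 * ‖v‖ := by gcongr; exact min_le_right _ _
      _ < ε := by
        rw [div_div, div_mul_eq_mul_div, div_lt_iff₀ (by positivity)]
        nlinarith

theorem HasCorner.exists_ball {d y : D} {p : ℂ} {q : ℂ → Prop}
    (h : ∀ᶠ z in 𝓝[R.sector d y p] p, q z) :
    ∃ ε > 0, ∀ z ∈ Metric.ball p ε, z ∈ R.sector d y p → q z := by
  rw [eventually_nhdsWithin_iff, Metric.eventually_nhds_iff_ball] at h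
  exact h

/-- Points of `d` near its end, rotated slightly clockwise about the vertex, lie both in the corner
and to the left of `d`. The dichotomies then transfer membership both ways; `key` is applied to the
region and to its complement. -/
theorem hasCorner_iff_isSide_left {d y : D} (h : R.IsNext d y) {p : ℂ}
    (hp : p ∈ R.lift (R.src (R.rev d))) : R.HasCorner d y p ↔ R.IsSide d (p - R.vec d) := by
  have key : ∀ q : ℂ → Prop, (∀ᶠ z in 𝓝[R.sector d y p] p, q z) → ∃ τ ∈ Ioo (0 : ℝ) 1,
      ∃ᶠ z in 𝓝[R.leftHalf d (p - R.vec d)] (p - R.vec d + τ * R.vec d), q z := by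
    intro q hq
    obtain ⟨ε, hε, h'⟩ := HasCorner.exists_ball hq
    obtain ⟨ρ, hρ, hρ1, hρε⟩ := exists_small ε hε (R.vec (R.rev d))
    refine ⟨1 - ρ, ⟨by linarith, by linarith⟩, ?_⟩
    refine (tendsto_rotate_end d p hρ).frequently (Eventually.frequently ?_)
    filter_upwards [eventually_rotate_end_mem_sector (d := d) (y := y) p hρ] with δ hδ
    refine h' _ ?_ hδ
    rw [Metric.mem_ball, dist_eq_norm, add_sub_cancel_left, norm_mul_vec_mul_exp hρ]
    exact hρε
  constructor
  · intro hc
    obtain ⟨τ, hτ, hq⟩ := key _ hc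
    exact isSide_of_frequently (R.lift_src d p hp) hτ hq
  · intro hs
    refine (sectorGerm_dichotomy h hp).resolve_right fun hn => ?_
    obtain ⟨τ, hτ, hq⟩ := key _ hn
    exact hq ((hs.2 τ hτ).mono fun z hz hz' => hz' hz)

theorem hasCorner_iff_isSide_right {d y : D} (h : R.IsNext d y) {p : ℂ}
    (hp : p ∈ R.lift (R.src (R.rev d))) : R.HasCorner d y p ↔ R.IsSide y p := by
  have key : ∀ q : ℂ → Prop, (∀ᶠ z in 𝓝[R.sector d y p] p, q z) → ∃ τ ∈ Ioo (0 : ℝ) 1,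
      ∃ᶠ z in 𝓝[R.leftHalf y p] (p + τ * R.vec y), q z := by
    intro q hq
    obtain ⟨ε, hε, h'⟩ := HasCorner.exists_ball hq
    obtain ⟨ρ, hρ, hρ1, hρε⟩ := exists_small ε hε (R.vec y)
    refine ⟨ρ, ⟨hρ, hρ1⟩, ?_⟩
    refine (tendsto_rotate_start y p hρ).frequently (Eventually.frequently ?_)
    filter_upwards [eventually_rotate_start_mem_sector (d := d) (y := y) p hρ] with δ hδ
    refine h' _ ?_ hδ
    rw [Metric.mem_ball, dist_eq_norm, add_sub_cancel_left, norm_mul_vec_mul_exp hρ]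
    exact hρε
  constructor
  · intro hc
    obtain ⟨τ, hτ, hq⟩ := key _ hc
    exact isSide_of_frequently (by rw [h.1]; exact hp) hτ hq
  · intro hs
    refine (sectorGerm_dichotomy h hp).resolve_right fun hn => ?_
    obtain ⟨τ, hτ, hq⟩ := key _ hn
    exact hq ((hs.2 τ hτ).mono fun z hz hz' => hz' hz)

/-- The base point of a side is unique. -/
theorem IsSide.unique {d : D} {b b' : ℂ} (h : R.IsSide d b) (h' : R.IsSide d b') : b = b' := by
  have hmem : ∀ {c : ℂ}, R.IsSide d c → ∀ᶠ s : ℝ in 𝓝[>] 0,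
      c + ((1 / 2 : ℝ) + s * I) * R.vec d ∈ R.region := by
    intro c hc
    refine Tendsto.eventually ?_ (hc.2 (1 / 2) (by norm_num))
    refine tendsto_nhdsWithin_of_tendsto_nhds_of_eventually_within _ ?_ ?_
    · refine Tendsto.mono_left ?_ nhdsWithin_le_nhds
      exact Continuous.tendsto' (by fun_prop) _ _ (by simp)
    · filter_upwards [self_mem_nhdsWithin] with s hs
      exact add_mul_mem_leftHalf d c _ (by simpa using hs)
  -- At a common small height, the points to the left of the two midpoints differ by the translation
  -- `b' - b`, which `lift_unique` forbids unless it is zero.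
  obtain ⟨s, h1, h2⟩ := ((hmem h).and (hmem h')).exists
  refine R.lift_unique _ b h.1 b' h'.1 _ h1 ?_
  convert h2 using 1; ring

/-- The vertical line through the corner points into the corner. -/
def IsUpCorner (R : PlanarRegion V D) (d y : D) : Prop :=
  ccwAngle (R.vec y) I < ccwAngle (R.vec y) (R.vec (R.rev d))

theorem add_mul_I_mem_sector {d y : D} (h : R.IsUpCorner d y) (p : ℂ) {s : ℝ} (hs : 0 < s) :
    p + s * I ∈ R.sector d y p := by
  have hs' : (s : ℂ) ≠ 0 := by exact_mod_cast hs.ne'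
  refine ⟨by simp [hs'], ?_⟩
  obtain ⟨r, hr, h2⟩ := exists_eq_mul_exp_ccwAngle (vec_ne_zero (R := R) y) I_ne_zero
  rw [add_sub_cancel_left]
  have h3 : ccwAngle (R.vec y) (s * I) = ccwAngle (R.vec y) I := by
    refine ccwAngle_eq (vec_ne_zero y) (mul_pos hs hr) (ccwAngle_pos _ _) (ccwAngle_le _ _) ?_
    push_cast
    linear_combination (s : ℂ) * h2
  rw [h3]
  exact h

theorem tendsto_add_mul_I (p c : ℂ) : Tendsto (fun s : ℝ => p + s * c) (𝓝[>] 0) (𝓝 p) := by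
  refine Tendsto.mono_left ?_ nhdsWithin_le_nhds
  exact Continuous.tendsto' (by fun_prop) _ _ (by simp)

theorem tendsto_add_mul_I_sector {d y : D} (h : R.IsUpCorner d y) (p : ℂ) :
    Tendsto (fun s : ℝ => p + s * I) (𝓝[>] 0) (𝓝[R.sector d y p] p) := by
  refine tendsto_nhdsWithin_of_tendsto_nhds_of_eventually_within _ (tendsto_add_mul_I p I) ?_
  filter_upwards [self_mem_nhdsWithin] with s hs
  exact add_mul_I_mem_sector h p hs

theorem HasCorner.eventually_up {d y : D} (h : R.IsUpCorner d y) {p : ℂ} (hc : R.HasCorner d y p) :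
    ∀ᶠ s : ℝ in 𝓝[>] 0, p + s * I ∈ R.region :=
  (tendsto_add_mul_I_sector h p).eventually hc

/-- The outgoing side of an upward corner is the first dart clockwise from the vertical. This
determines the corner at each vertex. -/
theorem IsUpCorner.le_ccwAngle {d y : D} (hn : R.IsNext d y) (h : R.IsUpCorner d y) {w : D}
    (hw : R.src w = R.src (R.rev d)) : ccwAngle (R.vec y) I ≤ ccwAngle (R.vec w) I := by
  have h1 := hn.le_ccwAngle hw
  have h2 := ccwAngle_of_le (vec_ne_zero y) I_ne_zero (vec_ne_zero w) (h.le.trans h1)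
  have h3 := ccwAngle_le (R.vec y) (R.vec w)
  linarith

theorem IsUpCorner.unique {d y d' y' : D} (hn : R.IsNext d y) (h : R.IsUpCorner d y)
    (hn' : R.IsNext d' y') (h' : R.IsUpCorner d' y') (hs : R.src (R.rev d) = R.src (R.rev d')) :
    d = d' := by
  have h1 := h.le_ccwAngle hn (w := y') (hn'.1.trans hs.symm)
  have h2 := h'.le_ccwAngle hn' (w := y) (hn.1.trans hs)
  have h3 := le_antisymm h1 h2
  obtain ⟨r, hr, hr'⟩ := exists_eq_mul_exp_ccwAngle (vec_ne_zero (R := R) y) I_ne_zero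
  obtain ⟨s, hs', hs''⟩ := exists_eq_mul_exp_ccwAngle (vec_ne_zero (R := R) y') I_ne_zero
  rw [← h3] at hs''
  have hs0 : (s : ℂ) ≠ 0 := by exact_mod_cast hs'.ne'
  have h4 : R.vec y' = (r / s : ℝ) * R.vec y := by
    have := hr'.symm.trans hs''
    have h5 := mul_right_cancel₀ (Complex.exp_ne_zero _) this
    push_cast
    field_simp
    linear_combination -h5
  have h5 : y = y' := eq_of_vec_eq ((hn.1.trans hs).trans hn'.1.symm) (div_pos hr hs') h4
  subst h5
  exact hn.left_unique hn'

/-- Every vertex with the region immediately above it has an upward corner. -/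
theorem exists_upCorner [Finite D] {next : D → D} (hn : ∀ d, R.IsNext d (next d))
    {v : V} {p : ℂ} (hp : p ∈ R.lift v) (hup : ∃ᶠ s : ℝ in 𝓝[>] 0, p + s * I ∈ R.region) :
    ∃ d, R.src (R.rev d) = v ∧ R.IsUpCorner d (next d) ∧ R.HasCorner d (next d) p := by
  -- The successor map permutes the darts, so the dart nearest to the vertical on its clockwise side
  -- is the outgoing side of some corner.
  have hsurj : Function.Surjective next := Finite.surjective_of_injective
    fun a b hab => (hn a).left_unique (hab ▸ hn b)
  obtain ⟨y, hyv, hy⟩ := Set.exists_min_image {y | R.src y = v} (fun y => ccwAngle (R.vec y) I)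
    (Set.toFinite _) (R.exists_dart v)
  obtain ⟨d, rfl⟩ := hsurj y
  have hv : R.src (R.rev d) = v := (hn d).1.symm.trans hyv
  have hcor : R.IsUpCorner d (next d) := by
    by_contra hcon
    unfold IsUpCorner at hcon
    rw [not_lt] at hcon
    rcases hcon.lt_or_eq with hlt | heq
    · have h1 := ccwAngle_of_lt (vec_ne_zero _) I_ne_zero (vec_ne_zero _) hlt
      have h2 := hy (R.rev d) hv
      have h3 := ccwAngle_pos (R.vec (next d)) (R.vec (R.rev d))
      linarith
    · obtain ⟨r, hr, h1⟩ := ccwAngle_inj (vec_ne_zero _) (vec_ne_zero _) I_ne_zero heq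
      have h2 := congrArg Complex.re h1
      simp at h2
      rcases h2 with h2 | h2
      · exact hr.ne' h2
      · exact R.vec_re_ne _ h2
  refine ⟨d, hv, hcor, (sectorGerm_dichotomy (hn d) (hv ▸ hp)).resolve_right fun h => ?_⟩
  exact hup (((tendsto_add_mul_I_sector hcor p).eventually h).mono fun s hs => by simpa using hs)

end PlanarRegion


/-! ### The vertical sweep: floors of points -/

/-- A segment from `p` that enters an open set `U` inside `C`: nearby segments inside `C` are
in `U`. -/
theorem eventually_segment_subset {U C : Set ℂ} (hU : IsOpen U) (κ p : ℂ) {s₀ : ℝ}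
    (hs₀ : 0 < s₀) (hseg : ∀ s ∈ Ioc 0 s₀, p + s * κ ∈ U) (hC : ∀ᶠ w in 𝓝[C] p, w ∈ U) :
    ∀ᶠ x : ℂ × ℝ in 𝓝 (p, s₀), (∀ s : ℝ, 0 < s → x.1 + s * κ ∈ C) →
      ∀ s ∈ Ioc 0 x.2, x.1 + s * κ ∈ U := by
  rw [eventually_nhdsWithin_iff, Metric.eventually_nhds_iff_ball] at hC
  obtain ⟨ε, hε, hball⟩ := hC
  -- The initial fraction `l` of the segment stays in the ball where `C` is inside `U`; the rest is
  -- compact in the open set `U`.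
  obtain ⟨l, hl, hl1, hlε⟩ : ∃ l : ℝ, 0 < l ∧ l < 1 ∧ l * (s₀ * ‖κ‖) < ε := by
    refine ⟨min (1 / 2) (ε / (s₀ * ‖κ‖ + 1) / 2), by positivity, ?_, ?_⟩
    · exact (min_le_left _ _).trans_lt (by norm_num)
    · have h1 : 0 ≤ s₀ * ‖κ‖ := by positivity
      calc _ ≤ ε / (s₀ * ‖κ‖ + 1) / 2 * (s₀ * ‖κ‖) := by gcongr; exact min_le_right _ _
        _ < ε := by
          rw [div_div, div_mul_eq_mul_div, div_lt_iff₀ (by positivity)]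
          nlinarith
  have h1 : ∀ᶠ x : ℂ × ℝ in 𝓝 (p, s₀), ∀ m ∈ Icc l 1, x.1 + ((m * x.2 : ℝ) : ℂ) * κ ∈ U := by
    refine isCompact_Icc.eventually_forall_of_forall_eventually fun m hm => ?_
    have hc : Continuous fun y : (ℂ × ℝ) × ℝ => y.1.1 + ((y.2 * y.1.2 : ℝ) : ℂ) * κ := by fun_prop
    refine hc.continuousAt.eventually (hU.mem_nhds ?_)
    exact hseg _ ⟨mul_pos (hl.trans_le hm.1) hs₀, by nlinarith [hm.2]⟩
  have h2 : ∀ᶠ x : ℂ × ℝ in 𝓝 (p, s₀), ‖x.1 - p‖ + l * (x.2 * ‖κ‖) < ε := by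
    refine Tendsto.eventually_lt_const (v := l * (s₀ * ‖κ‖)) hlε ?_
    exact Continuous.tendsto' (by fun_prop) _ _ (by simp)
  filter_upwards [h1, h2] with x hx1 hx2 hxC s hs
  have hx : 0 < x.2 := hs.1.trans_le hs.2
  rcases le_or_gt l (s / x.2) with h | h
  · have := hx1 (s / x.2) ⟨h, (div_le_one hx).2 hs.2⟩
    rwa [div_mul_cancel₀ _ hx.ne'] at this
  · refine hball _ ?_ (hxC s hs.1)
    rw [div_lt_iff₀ hx] at h
    rw [Metric.mem_ball, dist_eq_norm]
    calc ‖x.1 + s * κ - p‖ = ‖(x.1 - p) + s * κ‖ := by congr 1; ring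
      _ ≤ ‖x.1 - p‖ + s * ‖κ‖ := by
        refine (norm_add_le _ _).trans ?_
        rw [norm_mul, Complex.norm_real, Real.norm_of_nonneg hs.1.le]
      _ ≤ ‖x.1 - p‖ + (l * x.2) * ‖κ‖ := by gcongr
      _ < ε := by rw [mul_assoc]; exact hx2

namespace PlanarRegion

variable {V D : Type*} {R : PlanarRegion V D}

/-- The side `d`, starting at `b`, is directly below the point `z` of the region. -/
def Floor (R : PlanarRegion V D) (z : ℂ) (d : D) (b : ℂ) : Prop :=
  0 < (R.vec d).re ∧ b ∈ R.lift (R.src d) ∧ ∃ τ ∈ Ioo (0 : ℝ) 1, ∃ s : ℝ, 0 < s ∧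
    z = b + τ * R.vec d + s * I ∧ ∀ s' ∈ Ioc 0 s, b + τ * R.vec d + s' * I ∈ R.region

theorem add_mul_I_mem_leftHalf {d : D} (hd : 0 < (R.vec d).re) (b : ℂ) (t : ℝ) {s : ℝ}
    (hs : 0 < s) : b + t * R.vec d + s * I ∈ R.leftHalf d b := by
  have : b + t * R.vec d + s * I = b + (t + s * (I / R.vec d)) * R.vec d := by
    have := vec_ne_zero (R := R) d
    field_simp
    ring
  rw [this]
  apply add_mul_mem_leftHalf
  have h1 : 0 < (I / R.vec d).im := by
    rw [im_div_pos_iff (vec_ne_zero d)]; simpa using hd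
  rw [Complex.add_im, Complex.im_ofReal_mul, Complex.ofReal_im, zero_add]
  exact mul_pos hs h1

theorem Floor.mem_region {z : ℂ} {d : D} {b : ℂ} (h : R.Floor z d b) : z ∈ R.region := by
  obtain ⟨-, -, τ, -, s, hs, rfl, h⟩ := h
  exact h s ⟨hs, le_rfl⟩

theorem Floor.isSide {z : ℂ} {d : D} {b : ℂ} (h : R.Floor z d b) : R.IsSide d b := by
  obtain ⟨hd, hb, τ, hτ, s, hs, rfl, h⟩ := h
  refine isSide_of_frequently hb hτ ?_
  have : Tendsto (fun s : ℝ => b + τ * R.vec d + s * I) (𝓝[>] 0)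
      (𝓝[R.leftHalf d b] (b + τ * R.vec d)) := by
    refine tendsto_nhdsWithin_of_tendsto_nhds_of_eventually_within _ (tendsto_add_mul_I _ I) ?_
    filter_upwards [self_mem_nhdsWithin] with s hs
    exact add_mul_I_mem_leftHalf hd b τ hs
  refine this.frequently (Eventually.frequently ?_)
  filter_upwards [Ioc_mem_nhdsGT hs] with s' hs' using h s' hs'

/-- The first exit point below `z` lies on the drawing, since otherwise a ball around it would miss
the drawing, meet the region and hence be in it. -/
theorem exists_bottom {z : ℂ} (hz : z ∈ R.region) : ∃ s : ℝ, 0 < s ∧ z - s * I ∈ R.graph ∧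
    ∀ s' ∈ Ioc 0 s, z - s * I + s' * I ∈ R.region := by
  obtain ⟨s₁, hs₁, hns₁⟩ := R.exists_notMem_below z hz
  set T : Set ℝ := {s | 0 ≤ s ∧ z - s * I ∉ R.region} with hT
  have hclosed : IsClosed T := by
    have : T = Ici 0 ∩ (fun s : ℝ => z - s * I) ⁻¹' (R.regionᶜ) := rfl
    rw [this]
    exact isClosed_Ici.inter (isOpen_region.isClosed_compl.preimage (by fun_prop))
  have hbdd : BddBelow T := ⟨0, fun s hs => hs.1⟩
  have hmem : sInf T ∈ T := hclosed.csInf_mem ⟨s₁, hs₁.le, hns₁⟩ hbdd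
  set s := sInf T with hs
  have hlt : ∀ s', 0 ≤ s' → s' < s → z - s' * I ∈ R.region := by
    intro s' h0 h1
    by_contra h2
    exact absurd (csInf_le hbdd ⟨h0, h2⟩) (not_le.2 h1)
  have hpos : 0 < s := by
    rcases hmem.1.lt_or_eq with h | h
    · exact h
    · exfalso; apply hmem.2; rw [← h]; simpa using hz
  refine ⟨s, hpos, ?_, ?_⟩
  · by_contra hng
    obtain ⟨ε, hε, h⟩ := exists_ball_disjoint_graph hng
    refine hmem.2 (subset_region (convex_ball _ ε).isPreconnected h ?_ (Metric.mem_ball_self hε))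
    have h1 : ∀ᶠ s' : ℝ in 𝓝[>] 0, z - s * I + s' * I ∈ Metric.ball (z - s * I) ε :=
      (tendsto_add_mul_I _ I).eventually (Metric.ball_mem_nhds _ hε)
    obtain ⟨s', h2, h3⟩ := (h1.and (Ioo_mem_nhdsGT hpos)).exists
    refine ⟨_, h2, ?_⟩
    convert hlt (s - s') (by linarith [h3.2]) (by linarith [h3.1]) using 1
    push_cast; ring
  · intro s' hs'
    convert hlt (s - s') (by linarith [hs'.2]) (by linarith [hs'.1]) using 1
    push_cast; ring

/-- `z` is above the vertex `p`, with nothing in between. -/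
def Above (R : PlanarRegion V D) (p z : ℂ) : Prop :=
  ∃ s : ℝ, 0 < s ∧ z = p + s * I ∧ ∀ s' ∈ Ioc 0 s, p + s' * I ∈ R.region

theorem Floor.of_edge {z : ℂ} {d : D} {b : ℂ} (hb : b ∈ R.lift (R.src d)) {τ : ℝ}
    (hτ : τ ∈ Ioo (0 : ℝ) 1) {s : ℝ} (hs : 0 < s) (hz : z = b + τ * R.vec d + s * I)
    (h : ∀ s' ∈ Ioc 0 s, b + τ * R.vec d + s' * I ∈ R.region) : ∃ d b, R.Floor z d b := by
  rcases lt_or_gt_of_ne (R.vec_re_ne d) with hd | hd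
  · refine ⟨R.rev d, b + R.vec d, by rw [R.vec_rev]; simpa using hd, R.lift_dst d b hb, 1 - τ,
      ⟨by linarith [hτ.2], by linarith [hτ.1]⟩, s, hs, ?_⟩
    have : b + R.vec d + ((1 - τ : ℝ) : ℂ) * R.vec (R.rev d) = b + τ * R.vec d := by
      rw [R.vec_rev]; push_cast; ring
    rw [this]
    exact ⟨hz, h⟩
  · exact ⟨d, b, hd, hb, τ, hτ, s, hs, hz, h⟩

/-- These are the cells and the walls of the decomposition: the bottom of `z` is interior to an edge
or is a vertex. -/
theorem floor_or_above {z : ℂ} (hz : z ∈ R.region) :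
    (∃ d b, R.Floor z d b) ∨ ∃ v, ∃ p ∈ R.lift v, R.Above p z := by
  obtain ⟨s, hs, ⟨d, b, hb, t, ht, he⟩, h⟩ := exists_bottom hz
  have hz' : z = z - s * I + s * I := by ring
  rcases ht.1.lt_or_eq with h0 | h0
  · rcases ht.2.lt_or_eq with h1 | h1
    · rw [he] at h hz'
      exact Or.inl (Floor.of_edge hb ⟨h0, h1⟩ hs hz' h)
    · refine Or.inr ⟨R.src (R.rev d), z - s * I, ?_, s, hs, hz', h⟩
      rw [he, h1]; simpa using R.lift_dst d b hb
  · refine Or.inr ⟨R.src d, z - s * I, ?_, s, hs, hz', h⟩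
    rw [he, ← h0]; simpa using hb

/-- The bottom point of a vertical segment in the region is unique. -/
theorem bottom_unique {q q' : ℂ} (hq : q ∈ R.graph) (hq' : q' ∈ R.graph) {s s' : ℝ} (hs : 0 < s)
    (hs' : 0 < s') (h : ∀ r ∈ Ioc 0 s, q + r * I ∈ R.region)
    (h' : ∀ r ∈ Ioc 0 s', q' + r * I ∈ R.region) (he : q + s * I = q' + s' * I) : q = q' := by
  rcases lt_trichotomy s s' with hlt | rfl | hlt
  · refine absurd hq (region_disjoint_graph ?_)
    convert h' (s' - s) ⟨by linarith, by linarith⟩ using 1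
    push_cast; linear_combination he
  · exact add_right_cancel he
  · refine absurd hq' (region_disjoint_graph ?_)
    convert h (s - s') ⟨by linarith, by linarith⟩ using 1
    push_cast; linear_combination -he

theorem edge_mem_graph {d : D} {b : ℂ} (hb : b ∈ R.lift (R.src d)) {τ : ℝ}
    (hτ : τ ∈ Ioo (0 : ℝ) 1) : b + τ * R.vec d ∈ R.graph := ⟨d, b, hb, τ, ⟨hτ.1.le, hτ.2.le⟩, rfl⟩

theorem Floor.unique {z : ℂ} {d d' : D} {b b' : ℂ} (h : R.Floor z d b) (h' : R.Floor z d' b') :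
    d = d' ∧ b = b' := by
  obtain ⟨hd, hb, τ, hτ, s, hs, rfl, h⟩ := h
  obtain ⟨hd', hb', τ', hτ', s', hs', he, h'⟩ := h'
  have := bottom_unique (edge_mem_graph hb hτ) (edge_mem_graph hb' hτ') hs hs' h h' he
  rcases R.edge_inj d d' b hb b' hb' τ hτ τ' hτ' this with ⟨rfl, rfl⟩ | ⟨rfl, rfl⟩
  · exact ⟨rfl, rfl⟩
  · rw [R.vec_rev, Complex.neg_re] at hd'
    linarith

/-- The vertical projection of `z` to the line through `b` with direction `v`. -/
def vproj (b v z : ℂ) : ℂ := b + ((z.re - b.re) / v.re : ℝ) * v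

theorem continuous_vproj (b v : ℂ) : Continuous (vproj b v) := by
  unfold vproj; fun_prop

theorem vproj_add {b v : ℂ} (hv : v.re ≠ 0) (z : ℂ) :
    vproj b v z + ((z - vproj b v z).im : ℝ) * I = z := by
  have : (vproj b v z).re = z.re := by
    unfold vproj
    rw [Complex.add_re, Complex.re_ofReal_mul, div_mul_cancel₀ _ hv]; ring
  apply Complex.ext
  · simp [this]
  · simp

theorem vproj_add_mul {b v : ℂ} (hv : v.re ≠ 0) (t s : ℝ) :
    vproj b v (b + t * v + s * I) = b + t * v := by
  unfold vproj
  simp [hv]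

/-- Points near a vertical segment have the side below its bottom end as their floor. -/
theorem eventually_floor {d : D} (hd : 0 < (R.vec d).re) {b p : ℂ} (hb : b ∈ R.lift (R.src d))
    {τ₀ : ℝ} (hp : p = b + τ₀ * R.vec d) {C : Set ℂ} {s₀ : ℝ} (hs₀ : 0 < s₀)
    (hseg : ∀ s ∈ Ioc 0 s₀, p + s * I ∈ R.region) (hC : ∀ᶠ w in 𝓝[C] p, w ∈ R.region) :
    ∀ᶠ z in 𝓝 (p + s₀ * I), (z.re - b.re) / (R.vec d).re ∈ Ioo (0 : ℝ) 1 →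
      (∀ s : ℝ, 0 < s → vproj b (R.vec d) z + s * I ∈ C) → R.Floor z d b := by
  have h1 := eventually_segment_subset isOpen_region I p hs₀ hseg hC
  have hpp : vproj b (R.vec d) (p + s₀ * I) = p := by rw [hp, vproj_add_mul hd.ne']
  have hc : Tendsto (fun z => (vproj b (R.vec d) z, (z - vproj b (R.vec d) z).im))
      (𝓝 (p + s₀ * I)) (𝓝 (p, s₀)) := by
    have := continuous_vproj b (R.vec d)
    refine Continuous.tendsto' (by fun_prop) _ _ ?_
    rw [hpp]; simp
  have h2 : ∀ᶠ z in 𝓝 (p + s₀ * I), 0 < (z - vproj b (R.vec d) z).im := by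
    refine Tendsto.eventually_const_lt (v := s₀) hs₀ ?_
    exact (continuous_snd.tendsto _).comp hc
  filter_upwards [hc.eventually h1, h2] with z hz1 hz2 hz3 hz4
  exact ⟨hd, hb, _, hz3, _, hz2, (vproj_add hd.ne' z).symm, hz1 hz4⟩

theorem Floor.eventually {z₀ : ℂ} {d : D} {b : ℂ} (h : R.Floor z₀ d b) :
    ∀ᶠ z in 𝓝 z₀, R.Floor z d b := by
  have hside := h.isSide
  obtain ⟨hd, hb, τ, hτ, s, hs, rfl, h⟩ := h
  have h1 : ∀ᶠ z : ℂ in 𝓝 (b + τ * R.vec d + s * I),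
      (z.re - b.re) / (R.vec d).re ∈ Ioo (0 : ℝ) 1 := by
    have hc : Continuous fun z : ℂ => (z.re - b.re) / (R.vec d).re := by fun_prop
    refine hc.continuousAt.eventually (isOpen_Ioo.mem_nhds ?_)
    simpa [hd.ne'] using hτ
  filter_upwards [h1, eventually_floor hd hb rfl hs h (hside.2 τ hτ)] with z hz1 hz2
  exact hz2 hz1 fun s hs => add_mul_I_mem_leftHalf hd b _ hs

theorem Floor.extend {q : ℂ} {d : D} {b : ℂ} (h : R.Floor q d b) {s : ℝ} (hs : 0 ≤ s)
    (hseg : ∀ r ∈ Icc 0 s, q + r * I ∈ R.region) : R.Floor (q + s * I) d b := by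
  obtain ⟨hd, hb, τ, hτ, s₁, hs₁, rfl, h⟩ := h
  refine ⟨hd, hb, τ, hτ, s₁ + s, by linarith, by push_cast; ring, fun s' hs' => ?_⟩
  rcases le_or_gt s' s₁ with h1 | h1
  · exact h s' ⟨hs'.1, h1⟩
  · convert hseg (s' - s₁) ⟨by linarith, by linarith [hs'.2]⟩ using 1
    push_cast; ring

end PlanarRegion


/-! ### The floors on both sides of a vertical wall -/

namespace PlanarRegion

variable {V D : Type*} {R : PlanarRegion V D}

/-- Beside a vertex that does not obstruct the vertical, the floor is that of a point below it. -/
theorem exists_floor_below {v : V} {p : ℂ} (hp : p ∈ R.lift v) {C : Set ℂ}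
    (hC : ∀ᶠ w in 𝓝[C] p, w ∈ R.region) (hCI : ∀ z ∈ C, ∀ s : ℝ, z + s * I ∈ C)
    (hdown : ∀ᶠ s : ℝ in 𝓝[>] 0, p + s * (-I) ∈ R.region) :
    ∃ e b q, q.re = p.re ∧ q.im < p.im ∧ R.Floor q e b ∧
      ∀ z₀, R.Above p z₀ → ∀ᶠ z in 𝓝 z₀, z ∈ C → R.Floor z e b := by
  obtain ⟨η, hη, hη'⟩ := mem_nhdsGT_iff_exists_Ioc_subset.1 hdown
  rw [mem_Ioi] at hη
  set q : ℂ := p + η * (-I) with hq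
  have hqre : q.re = p.re := by simp [hq]
  have hqim : q.im = p.im - η := by simp [hq, sub_eq_add_neg]
  -- The point `q` is not above a vertex: the only vertex on its vertical line is `p`, which is
  -- higher.
  have hfloor : ∃ e b, R.Floor q e b := by
    refine (floor_or_above (z := q) (hη' ⟨hη, le_rfl⟩)).resolve_right ?_
    rintro ⟨w, p', hp', s, hs, he, -⟩
    have h1 : p'.re = p.re := by rw [← hqre, he]; simp
    have h2 : p' = p := R.re_inj w v p' hp' p hp h1
    have h3 := congrArg Complex.im he
    rw [hqim, h2] at h3
    simp at h3
    linarith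
  obtain ⟨e, b, hf⟩ := hfloor
  refine ⟨e, b, q, hqre, by rw [hqim]; linarith, hf, ?_⟩
  rintro z₀ ⟨s₀, hs₀, rfl, hseg⟩
  have hc : Tendsto (fun z : ℂ => z - s₀ * I) (𝓝 (p + s₀ * I)) (𝓝 p) :=
    Continuous.tendsto' (by fun_prop) _ _ (by simp)
  have h1 : ∀ᶠ z in 𝓝 (p + s₀ * I), R.Floor (z - s₀ * I + η * (-I)) e b := by
    have h5 : Tendsto (fun z : ℂ => z - s₀ * I + η * (-I)) (𝓝 (p + s₀ * I)) (𝓝 q) :=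
      Continuous.tendsto' (by fun_prop) _ _ (by rw [hq]; ring)
    have h6 : ∀ᶠ z in 𝓝 q, R.Floor z e b := Floor.eventually hf
    exact h5.eventually h6
  have h2 := (hc.prodMk_nhds (tendsto_const_nhds (x := s₀))).eventually
    (eventually_segment_subset isOpen_region I p hs₀ hseg hC)
  have h3 := (hc.prodMk_nhds (tendsto_const_nhds (x := η))).eventually
    (eventually_segment_subset isOpen_region (-I) p hη hη' hC)
  have h4 := hc.eventually (eventually_nhdsWithin_iff.1 hC)
  filter_upwards [h1, h2, h3, h4] with z hz1 hz2 hz3 hz4 hzC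
  have hz0 : ∀ s : ℝ, z - s₀ * I + s * I ∈ C := by
    intro s
    convert hCI z hzC (s - s₀) using 1
    push_cast; ring
  have hlow := hz3 fun s _ => by
    convert hz0 (-s) using 1
    push_cast; ring
  have hmid := hz4 (by simpa using hz0 0)
  have hup := hz2 fun s _ => hz0 s
  -- The vertical from near `q` up to `z` splits at the height of `p` into a lower segment, one
  -- point and an upper segment, all in the region.
  have := hz1.extend (s := η + s₀) (by linarith) fun r hr => by
    rcases lt_trichotomy r η with hlt | rfl | hlt
    · convert hlow (η - r) ⟨by linarith, by linarith [hr.1]⟩ using 1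
      push_cast; ring
    · convert hmid using 1
      ring
    · convert hup (r - η) ⟨by linarith, by linarith [hr.2]⟩ using 1
      push_cast; ring
  convert this using 1
  push_cast; ring

theorem eventually_re_div_mem_Ioo (p v z₀ : ℂ) (hz₀ : z₀.re = p.re) :
    ∀ᶠ z : ℂ in 𝓝 z₀, 0 < (z.re - p.re) / v.re → (z.re - p.re) / v.re ∈ Ioo (0 : ℝ) 1 := by
  have : Tendsto (fun z : ℂ => (z.re - p.re) / v.re) (𝓝 z₀) (𝓝 0) :=
    Continuous.tendsto' (by fun_prop) _ _ (by simp [hz₀])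
  filter_upwards [this.eventually_lt_const one_pos] with z h1 h2 using ⟨h2, h1⟩

/-- The floor immediately to the right of the vertical above an upward corner. -/
theorem exists_right_floor {d y : D} (hn : R.IsNext d y) (hup : R.IsUpCorner d y) {p : ℂ}
    (hp : p ∈ R.lift (R.src (R.rev d))) (hc : R.HasCorner d y p) :
    ∃ e b, (b = p ∨ ∃ q, q.re = p.re ∧ q.im < p.im ∧ R.Floor q e b) ∧
      ∀ z₀, R.Above p z₀ → ∀ᶠ z in 𝓝 z₀, p.re < z.re → R.Floor z e b := by
  rcases lt_or_gt_of_ne (R.vec_re_ne y) with hy | hy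
  -- If the outgoing side points left, the corner contains everything to the right of and directly
  -- below `p`, so the floor lies below `p`. In the other case the outgoing side itself is the
  -- floor.
  · have hsub : ∀ z : ℂ, (0 < (z - p).re ∨ (z - p).re = 0 ∧ (z - p).im < 0) →
        z ∈ R.sector d y p := by
      intro z hz
      refine ⟨by rintro rfl; simp at hz, (ccwAngle_lt_of_re_neg hy hz).trans hup⟩
    have hC : {z : ℂ | p.re < z.re} ⊆ R.sector d y p :=
      fun z hz => hsub z (Or.inl (by simpa using hz))
    have hdown : ∀ᶠ s : ℝ in 𝓝[>] 0, p + s * (-I) ∈ R.region := by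
      refine Tendsto.eventually (tendsto_nhdsWithin_of_tendsto_nhds_of_eventually_within _
        (tendsto_add_mul_I p (-I)) ?_) hc
      filter_upwards [self_mem_nhdsWithin] with s hs
      exact hsub _ (Or.inr (by simpa using hs))
    obtain ⟨e, b, q, h1, h2, h3, h4⟩ := exists_floor_below hp
      (C := {z : ℂ | p.re < z.re}) (hc.filter_mono (nhdsWithin_mono _ hC))
      (fun z hz s => by simpa using hz) hdown
    exact ⟨e, b, Or.inr ⟨q, h1, h2, h3⟩, h4⟩
  · refine ⟨y, p, Or.inl rfl, ?_⟩
    rintro z₀ ⟨s₀, hs₀, rfl, hseg⟩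
    have h1 := eventually_floor hy (hn.1 ▸ hp) (τ₀ := 0) (by simp) hs₀ hseg hc
    filter_upwards [h1, eventually_re_div_mem_Ioo p (R.vec y) (p + s₀ * I) (by simp)] with
      z hz1 hz2 hz3
    have hpos : 0 < (z.re - p.re) / (R.vec y).re := div_pos (by linarith) hy
    refine hz1 (hz2 hpos) fun s hs => ?_
    have h2 := ccwAngle_lt_of_mem_cone_right hy hpos hs
    have h3 : vproj p (R.vec y) z + s * I - p =
        ((z.re - p.re) / (R.vec y).re : ℝ) * R.vec y + s * I := by
      unfold vproj; ring
    rw [← h3] at h2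
    refine ⟨?_, h2.trans hup⟩
    intro h
    rw [h, sub_self] at h3
    have := congrArg Complex.re h3
    simp only [Complex.zero_re, Complex.add_re, Complex.re_ofReal_mul, Complex.I_re, mul_zero,
      add_zero] at this
    exact (mul_pos hpos hy).ne this

/-- The floor immediately to the left of the vertical above an upward corner. -/
theorem exists_left_floor {d y : D} (hup : R.IsUpCorner d y) {p : ℂ}
    (hp : p ∈ R.lift (R.src (R.rev d))) (hc : R.HasCorner d y p) :
    ∃ e b, ∀ z₀, R.Above p z₀ → ∀ᶠ z in 𝓝 z₀, z.re < p.re → R.Floor z e b := by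
  have hadd : ccwAngle (R.vec y) I + ccwAngle I (R.vec (R.rev d)) =
      ccwAngle (R.vec y) (R.vec (R.rev d)) := by
    rw [ccwAngle_of_lt (vec_ne_zero y) (vec_ne_zero _) I_ne_zero hup]; ring
  have hsec : ∀ z, z ≠ p → ccwAngle I (z - p) < ccwAngle I (R.vec (R.rev d)) →
      z ∈ R.sector d y p := by
    intro z hz h
    refine ⟨hz, ?_⟩
    have := ccwAngle_le (R.vec y) (R.vec (R.rev d))
    rw [ccwAngle_add (vec_ne_zero y) (sub_ne_zero.2 hz) I_ne_zero (by linarith)]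
    linarith
  have hre : (R.vec (R.rev d)).re = -(R.vec d).re := by rw [R.vec_rev]; rfl
  rcases lt_or_gt_of_ne (R.vec_re_ne d) with hy | hy
  · have hsub : ∀ z : ℂ, ((z - p).re < 0 ∨ (z - p).re = 0 ∧ (z - p).im < 0) →
        z ∈ R.sector d y p := by
      intro z hz
      exact hsec z (by rintro rfl; simp at hz)
        (ccwAngle_left_lt_of_re_pos (by rw [hre]; linarith) hz)
    have hC : {z : ℂ | z.re < p.re} ⊆ R.sector d y p :=
      fun z hz => hsub z (Or.inl (by simpa using hz))
    have hdown : ∀ᶠ s : ℝ in 𝓝[>] 0, p + s * (-I) ∈ R.region := by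
      refine Tendsto.eventually (tendsto_nhdsWithin_of_tendsto_nhds_of_eventually_within _
        (tendsto_add_mul_I p (-I)) ?_) hc
      filter_upwards [self_mem_nhdsWithin] with s hs
      exact hsub _ (Or.inr (by simpa using hs))
    obtain ⟨e, b, q, h1, h2, h3, h4⟩ := exists_floor_below hp
      (C := {z : ℂ | z.re < p.re}) (hc.filter_mono (nhdsWithin_mono _ hC))
      (fun z hz s => by simpa using hz) hdown
    exact ⟨e, b, h4⟩
  · refine ⟨d, p - R.vec d, ?_⟩
    rintro z₀ ⟨s₀, hs₀, rfl, hseg⟩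
    have h1 := eventually_floor hy (R.lift_src d p hp) (τ₀ := 1) (by simp) hs₀ hseg hc
    filter_upwards [h1, eventually_re_div_mem_Ioo p (R.vec (R.rev d)) (p + s₀ * I) (by simp)] with
      z hz1 hz2 hz3
    rw [hre] at hz2
    have hpos : 0 < (z.re - p.re) / -(R.vec d).re :=
      div_pos_of_neg_of_neg (by linarith) (by linarith)
    have hz2 := hz2 hpos
    have heq : (z.re - (p - R.vec d).re) / (R.vec d).re =
        1 - (z.re - p.re) / -(R.vec d).re := by
      rw [Complex.sub_re]; field_simp; ring
    refine hz1 (by rw [heq]; exact ⟨by linarith [hz2.2], by linarith [hz2.1]⟩) fun s hs => ?_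
    have h2 := ccwAngle_lt_of_mem_cone_left (x := R.vec (R.rev d)) (by rw [hre]; linarith) hpos hs
    have h3 : vproj (p - R.vec d) (R.vec d) z + s * I - p =
        ((z.re - p.re) / -(R.vec d).re : ℝ) * R.vec (R.rev d) + s * I := by
      unfold vproj; rw [heq, R.vec_rev]; push_cast; ring
    rw [← h3] at h2
    refine hsec _ ?_ h2
    intro h
    rw [h, sub_self] at h3
    have := congrArg Complex.re h3
    simp only [Complex.zero_re, Complex.add_re, Complex.re_ofReal_mul, Complex.I_re, mul_zero,
      add_zero, hre] at this
    have := mul_neg_of_pos_of_neg hpos (neg_neg_of_pos hy)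
    linarith

/-- Two points of a cell are joined by moving vertically to a common height ε above the side and
travelling parallel to it; compactness of the stretch of side between them provides ε. The set `J`
allows restriction to one side of a vertical line. -/
theorem isPreconnected_floor (d : D) (b : ℂ) {J : Set ℝ} (hJ : J.OrdConnected) :
    IsPreconnected {z | R.Floor z d b ∧ z.re ∈ J} := by
  refine isPreconnected_of_forall_pair ?_
  rintro x ⟨hx, hxJ⟩ y ⟨hy, hyJ⟩
  have hside := hx.isSide
  obtain ⟨hd, hb, τ₁, hτ₁, s₁, hs₁, rfl, h₁⟩ := hx
  obtain ⟨-, -, τ₂, hτ₂, s₂, hs₂, rfl, h₂⟩ := hy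
  have hτ : ∀ τ ∈ uIcc τ₁ τ₂, τ ∈ Ioo (0 : ℝ) 1 :=
    fun τ h => (ordConnected_Ioo.uIcc_subset hτ₁ hτ₂) h
  have hre : ∀ τ ∈ uIcc τ₁ τ₂, ∀ s : ℝ, (b + τ * R.vec d + s * I).re ∈ J := by
    intro τ h s
    refine hJ.uIcc_subset hxJ hyJ ?_
    simp only [Complex.add_re, Complex.re_ofReal_mul, Complex.I_re, mul_zero, add_zero]
    rw [mem_uIcc] at h ⊢
    rcases h with h | h
    · exact Or.inl ⟨by gcongr; exact h.1, by gcongr; exact h.2⟩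
    · exact Or.inr ⟨by gcongr; exact h.1, by gcongr; exact h.2⟩
  have hev : ∀ᶠ s : ℝ in 𝓝[>] 0, ∀ τ ∈ uIcc τ₁ τ₂, b + τ * R.vec d + s * I ∈ R.region := by
    have h : ∀ᶠ s : ℝ in 𝓝 0, ∀ τ ∈ uIcc τ₁ τ₂, 0 < s → b + τ * R.vec d + s * I ∈ R.region := by
      refine isCompact_uIcc.eventually_forall_of_forall_eventually fun τ h => ?_
      have h3 := eventually_nhdsWithin_iff.1 (hside.2 τ (hτ τ h))
      have hc : Tendsto (fun x : ℝ × ℝ => b + x.2 * R.vec d + x.1 * I) (𝓝 (0, τ))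
          (𝓝 (b + τ * R.vec d)) := Continuous.tendsto' (by fun_prop) _ _ (by simp)
      filter_upwards [hc.eventually h3] with x h4 h5
      exact h4 (add_mul_I_mem_leftHalf hd b _ h5)
    rw [eventually_nhdsWithin_iff]
    filter_upwards [h] with s hs hs0 τ hτ using hs τ hτ hs0
  obtain ⟨ε, hε, hε'⟩ := mem_nhdsGT_iff_exists_Ioc_subset.1 hev
  rw [mem_Ioi] at hε
  have hvert : ∀ τ ∈ uIcc τ₁ τ₂, ∀ s₀ : ℝ, 0 < s₀ →
      (∀ s ∈ Ioc 0 s₀, b + τ * R.vec d + s * I ∈ R.region) → ∀ s ∈ uIcc ε s₀,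
      R.Floor (b + τ * R.vec d + s * I) d b := by
    intro τ h s₀ hs₀ hseg s hs
    have hs0 : 0 < s := (lt_min hε hs₀).trans_le hs.1
    refine ⟨hd, hb, τ, hτ τ h, s, hs0, rfl, fun s' hs' => ?_⟩
    rcases le_total s' ε with h1 | h1
    · exact hε' ⟨hs'.1, h1⟩ τ h
    · rcases mem_uIcc.1 hs with h2 | h2
      · exact hseg _ ⟨hs'.1, hs'.2.trans h2.2⟩
      · exact hε' ⟨hs'.1, hs'.2.trans h2.2⟩ τ h
  refine ⟨(fun s : ℝ => b + τ₁ * R.vec d + s * I) '' uIcc ε s₁ ∪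
    ((fun τ : ℝ => b + τ * R.vec d + ε * I) '' uIcc τ₁ τ₂ ∪
    (fun s : ℝ => b + τ₂ * R.vec d + s * I) '' uIcc ε s₂), ?_, ?_, ?_, ?_⟩
  · rintro _ (⟨s, hs, rfl⟩ | ⟨τ, hτ', rfl⟩ | ⟨s, hs, rfl⟩)
    · exact ⟨hvert τ₁ left_mem_uIcc s₁ hs₁ h₁ s hs, hre τ₁ left_mem_uIcc s⟩
    · exact ⟨hvert τ hτ' ε hε (fun s hs => hε' hs τ hτ') ε left_mem_uIcc, hre τ hτ' ε⟩
    · exact ⟨hvert τ₂ right_mem_uIcc s₂ hs₂ h₂ s hs, hre τ₂ right_mem_uIcc s⟩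
  · exact Or.inl ⟨s₁, right_mem_uIcc, rfl⟩
  · exact Or.inr (Or.inr ⟨s₂, right_mem_uIcc, rfl⟩)
  · refine IsPreconnected.union (b + τ₁ * R.vec d + ε * I) ⟨ε, left_mem_uIcc, rfl⟩
      (Or.inl ⟨τ₁, left_mem_uIcc, rfl⟩) (isPreconnected_uIcc.image _ (by fun_prop)) ?_
    exact IsPreconnected.union (b + τ₂ * R.vec d + ε * I) ⟨τ₂, right_mem_uIcc, rfl⟩
      ⟨ε, left_mem_uIcc, rfl⟩ (isPreconnected_uIcc.image _ (by fun_prop))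
      (isPreconnected_uIcc.image _ (by fun_prop))

end PlanarRegion


/-! ### The Euler characteristic of the region -/

theorem IsPreconnected.eq_of_eventually_eq {α β : Type*} [TopologicalSpace α] {S : Set α}
    (hS : IsPreconnected S) {f : α → β} (h : ∀ x ∈ S, ∀ᶠ y in 𝓝[S] x, f y = f x) {x y : α}
    (hx : x ∈ S) (hy : y ∈ S) : f x = f y := by
  let _ : TopologicalSpace β := ⊥
  have : DiscreteTopology β := ⟨rfl⟩
  have hc : ContinuousOn f S := by
    intro x hx
    rw [ContinuousWithinAt, nhds_discrete, tendsto_pure]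
    exact h x hx
  exact (hS.image f hc).subsingleton (mem_image_of_mem f hx) (mem_image_of_mem f hy)

/-- A nonzero functional vanishing on the range would have an index of largest key in its support;
the vector provided for that index contradicts the vanishing. -/
theorem LinearMap.surjective_of_triangular {E K : Type*} [AddCommGroup E] [Module ℝ E] [Fintype K]
    (L : E →ₗ[ℝ] (K → ℝ)) (key : K → ℝ) (hkey : Function.Injective key)
    (h : ∀ c, ∃ x, L x c ≠ 0 ∧ ∀ c', key c' < key c → L x c' = 0) : Function.Surjective L := by
  classical
  rw [← LinearMap.range_eq_top]
  by_contra hne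
  obtain ⟨f, hf, hle⟩ := Submodule.exists_le_ker_of_lt_top _ (lt_top_iff_ne_top.2 hne)
  have hsum : ∀ g : K → ℝ, f g = ∑ c, g c * f (Pi.single c 1) := by
    intro g
    conv_lhs => rw [pi_eq_sum_univ' g]
    rw [map_sum]
    refine Finset.sum_congr rfl fun c _ => ?_
    rw [map_smul, smul_eq_mul]
  have hex : ∃ c, f (Pi.single c 1) ≠ 0 := by
    by_contra! hcon
    exact hf (LinearMap.ext fun g => by rw [hsum]; simp [hcon])
  obtain ⟨c, hc, hmax⟩ := Set.exists_max_image {c | f (Pi.single c 1) ≠ 0} key (Set.toFinite _) hex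
  obtain ⟨x, hx, hx'⟩ := h c
  have h0 : f (L x) = 0 := hle ⟨x, rfl⟩
  rw [hsum, Finset.sum_eq_single c] at h0
  · exact (mul_ne_zero hx hc) h0
  · intro c' _ hcc
    by_cases h1 : f (Pi.single c' 1) = 0
    · rw [h1, mul_zero]
    · rw [hx' c' (lt_of_le_of_ne (hmax c' h1) fun h2 => hcc (hkey h2)), zero_mul]
  · simp

theorem mem_slitPlane_of_not_ray {w : ℂ} (h : ∀ s : ℝ, 0 ≤ s → w ≠ s * I) :
    -(w / I) ∈ Complex.slitPlane := by
  rw [Complex.mem_slitPlane_iff]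
  by_contra! hcon
  obtain ⟨h1, h2⟩ := hcon
  simp at h1 h2
  refine h w.im h1 ?_
  apply Complex.ext <;> simp [h2]

theorem ccwAngle_I_lt_of_upper_left {w : ℂ} (h : w.re < 0) (h' : 0 < w.im) :
    ccwAngle I w < Real.pi / 2 := by
  have hre : (-(w / I)).re < 0 := by simpa using h'
  have him : (-(w / I)).im < 0 := by simpa using h
  have h1 := (Complex.arg_neg_iff).2 him
  have h2 := mt Complex.abs_arg_le_pi_div_two_iff.1 (not_le.2 hre)
  rw [not_le, abs_of_neg h1] at h2
  unfold ccwAngle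
  linarith

theorem lt_ccwAngle_I_of_upper_right {w : ℂ} (h : 0 < w.re) (h' : 0 < w.im) :
    3 * Real.pi / 2 < ccwAngle I w := by
  have hre : (-(w / I)).re < 0 := by simpa using h'
  have him : 0 < (-(w / I)).im := by simpa using h
  have h1 := (Complex.arg_nonneg_iff).2 him.le
  have h2 := mt Complex.abs_arg_le_pi_div_two_iff.1 (not_le.2 hre)
  rw [not_le, abs_of_nonneg h1] at h2
  unfold ccwAngle
  linarith

namespace PlanarRegion

variable {V D : Type*} {R : PlanarRegion V D}

/-- A function on the region that jumps exactly across the upward vertical ray from `p`. -/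
theorem exists_jump_function {v : V} {p : ℂ} (hp : p ∈ R.lift v) : ∃ F : ℂ → ℝ,
    (∀ z ∈ R.region, (∀ s : ℝ, 0 ≤ s → z ≠ p + s * I) → ∀ᶠ z' in 𝓝 z, F z' = F z) ∧
    ∀ z₀, R.Above p z₀ → ∃ U ∈ 𝓝 z₀, ∀ z ∈ U, ∀ z' ∈ U, z.re < p.re → p.re < z'.re →
      F z ≠ F z' := by
  have hpn : p ∉ R.region := fun h => region_disjoint_graph h (mem_graph_of_mem_lift hp)
  obtain ⟨A, hA, hA'⟩ := R.exists_angle p hpn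
  -- The global angle minus the branch cut along the upward ray, counted in full turns: an integer,
  -- and continuous off the ray.
  refine ⟨fun z => (A z - Real.pi / 2 - ccwAngle I (z - p)) / (2 * Real.pi), ?_, ?_⟩
  · intro z hz hray
    have hint : ∀ w ∈ R.region, ∃ n : ℤ,
        (A w - Real.pi / 2 - ccwAngle I (w - p)) / (2 * Real.pi) = n := by
      intro w hw
      have hwp : w - p ≠ 0 := sub_ne_zero.2 fun h => hpn (h ▸ hw)
      obtain ⟨r, hr, h1⟩ := exists_eq_mul_exp_ccwAngle I_ne_zero hwp
      have hnorm : ‖w - p‖ = r := by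
        conv_lhs => rw [h1]
        rw [norm_mul, norm_mul, Complex.norm_exp_ofReal_mul_I, Complex.norm_real,
          Real.norm_of_nonneg hr.le, Complex.norm_I]
        ring
      have h2 := hA' w hw
      rw [hnorm] at h2
      have hr0 : (r : ℂ) ≠ 0 := by exact_mod_cast hr.ne'
      have h3 : exp (A w * I) = exp (Real.pi / 2 * I + ccwAngle I (w - p) * I) := by
        rw [Complex.exp_add, Complex.exp_pi_div_two_mul_I]
        refine mul_left_cancel₀ hr0 ?_
        rw [← h2]
        linear_combination h1
      obtain ⟨n, hn⟩ := Complex.exp_eq_exp_iff_exists_int.1 h3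
      refine ⟨n, ?_⟩
      rw [div_eq_iff (by positivity)]
      have h4 := congrArg Complex.im hn
      simp at h4
      have h5 : (n : ℝ) * (2 * Real.pi) = A w - (Real.pi / 2 + ccwAngle I (w - p)) := by
        linarith
      linarith
    have hcont : ContinuousAt
        (fun z => (A z - Real.pi / 2 - ccwAngle I (z - p)) / (2 * Real.pi)) z := by
      have h1 : ContinuousAt A z := hA.continuousAt (isOpen_region.mem_nhds hz)
      have h2 : ContinuousAt (fun z => ccwAngle I (z - p)) z := by
        unfold ccwAngle
        refine ContinuousAt.add ?_ continuousAt_const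
        have h3 : -((z - p) / I) ∈ Complex.slitPlane := mem_slitPlane_of_not_ray fun s hs h =>
          hray s hs (by rw [← h]; ring)
        exact ContinuousAt.comp (f := fun z => -((z - p) / I)) (Complex.continuousAt_arg h3)
          (by fun_prop)
      exact ((h1.sub continuousAt_const).sub h2).div_const _
    filter_upwards [isOpen_region.mem_nhds hz, Metric.continuousAt_iff'.1 hcont 1 one_pos] with
      z' hz' hd
    obtain ⟨n, hn⟩ := hint z hz
    obtain ⟨m, hm⟩ := hint z' hz'
    rw [hn, hm, Real.dist_eq] at hd
    rw [hn, hm]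
    have : |m - n| < 1 := by exact_mod_cast hd
    have := Int.abs_lt_one_iff.1 this
    exact_mod_cast sub_eq_zero.1 this
  · rintro z₀ ⟨s, hs, rfl, hseg⟩
    have hz₀ : p + s * I ∈ R.region := hseg s ⟨hs, le_rfl⟩
    have h1 : ContinuousAt A (p + s * I) := hA.continuousAt (isOpen_region.mem_nhds hz₀)
    have h2 : ∀ᶠ z in 𝓝 (p + s * I), dist (A z) (A (p + s * I)) < Real.pi / 2 :=
      Metric.continuousAt_iff'.1 h1 _ (by positivity)
    have h3 : ∀ᶠ z : ℂ in 𝓝 (p + s * I), 0 < (z - p).im := by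
      refine Tendsto.eventually_const_lt (v := s) hs ?_
      exact Continuous.tendsto' (by fun_prop) _ _ (by simp)
    -- Across the ray the branch jumps by more than π, while `A` varies by less than π on this
    -- neighbourhood.
    refine ⟨_, h2.and h3, ?_⟩
    rintro z ⟨hz1, hz2⟩ z' ⟨hz1', hz2'⟩ hzl hzr heq
    have h4 := ccwAngle_I_lt_of_upper_left (w := z - p) (by simpa using hzl) hz2
    have h5 := lt_ccwAngle_I_of_upper_right (w := z' - p) (by simpa using hzr) hz2'
    rw [div_left_inj' (by positivity)] at heq
    rw [Real.dist_eq, abs_lt] at hz1 hz1'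
    linarith [hz1.1, hz1.2, hz1'.1, hz1'.2]

/-- The sides with the region above. -/
def IsFloorSide (R : PlanarRegion V D) (d : D) : Prop := (∃ b, R.IsSide d b) ∧ 0 < (R.vec d).re

/-- The sides that end at an upward corner of the region. -/
def IsUpSide (R : PlanarRegion V D) (next : D → D) (d : D) : Prop :=
  (∃ b, R.IsSide d b) ∧ R.IsUpCorner d (next d)

theorem Floor.isFloorSide {z : ℂ} {d : D} {b : ℂ} (h : R.Floor z d b) : R.IsFloorSide d :=
  ⟨⟨b, h.isSide⟩, h.1⟩

theorem frequently_re_gt (z₀ : ℂ) : ∃ᶠ z : ℂ in 𝓝 z₀, z₀.re < z.re := by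
  have h : Tendsto (fun s : ℝ => z₀ + s * 1) (𝓝[>] 0) (𝓝 z₀) := tendsto_add_mul_I z₀ 1
  refine h.frequently (Eventually.frequently ?_)
  filter_upwards [self_mem_nhdsWithin] with s hs
  simpa using hs

theorem frequently_re_lt (z₀ : ℂ) : ∃ᶠ z : ℂ in 𝓝 z₀, z.re < z₀.re := by
  have h : Tendsto (fun s : ℝ => z₀ + s * (-1)) (𝓝[>] 0) (𝓝 z₀) := tendsto_add_mul_I z₀ (-1)
  refine h.frequently (Eventually.frequently ?_)
  filter_upwards [self_mem_nhdsWithin] with s hs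
  simpa using hs

theorem Above.re_eq {p z : ℂ} (h : R.Above p z) : z.re = p.re := by
  obtain ⟨s, -, rfl, -⟩ := h
  simp

theorem Above.mem_region {p z : ℂ} (h : R.Above p z) : z ∈ R.region := by
  obtain ⟨s, hs, rfl, h⟩ := h
  exact h s ⟨hs, le_rfl⟩

theorem HasCorner.exists_above {d y : D} (h : R.IsUpCorner d y) {p : ℂ} (hc : R.HasCorner d y p) :
    ∃ z₀, R.Above p z₀ := by
  obtain ⟨s, hs, hs'⟩ := mem_nhdsGT_iff_exists_Ioc_subset.1 (hc.eventually_up h)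
  exact ⟨_, s, hs, rfl, hs'⟩

theorem exists_floors_of_upSide {next : D → D} (hn : ∀ d, R.IsNext d (next d)) {c : D}
    (hc : R.IsUpSide next c) : ∃ p ∈ R.lift (R.src (R.rev c)), R.HasCorner c (next c) p ∧
      ∃ r l : {d // R.IsFloorSide d}, ∃ br bl : ℂ,
      (br = p ∨ ∃ q, q.re = p.re ∧ q.im < p.im ∧ R.Floor q r br) ∧
      ∀ z₀, R.Above p z₀ → ∀ᶠ z in 𝓝 z₀,
        (p.re < z.re → R.Floor z r br) ∧ (z.re < p.re → R.Floor z l bl) := by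
  obtain ⟨⟨b, hb⟩, hup⟩ := hc
  have hp := R.lift_dst c b hb.1
  have hcor : R.HasCorner c (next c) (b + R.vec c) :=
    (hasCorner_iff_isSide_left (hn c) hp).2 (by simpa using hb)
  obtain ⟨r, br, hbr, hr⟩ := exists_right_floor (hn c) hup hp hcor
  obtain ⟨l, bl, hl⟩ := exists_left_floor hup hp hcor
  obtain ⟨z₀, hz₀⟩ := hcor.exists_above hup
  obtain ⟨z, hz1, hz2⟩ := ((frequently_re_gt z₀).and_eventually (hr z₀ hz₀)).exists
  obtain ⟨z', hz1', hz2'⟩ := ((frequently_re_lt z₀).and_eventually (hl z₀ hz₀)).exists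
  rw [hz₀.re_eq] at hz1 hz1'
  refine ⟨_, hp, hcor, ⟨r, (hz2 hz1).isFloorSide⟩, ⟨l, (hz2' hz1').isFloorSide⟩, br, bl, hbr, ?_⟩
  intro z₀ hz₀
  exact (hr z₀ hz₀).and (hl z₀ hz₀)

theorem IsFloorSide.exists_floor {d : D} (h : R.IsFloorSide d) : ∃ z b, R.Floor z d b := by
  obtain ⟨⟨b, hb, hb'⟩, hd⟩ := h
  have h1 := eventually_nhdsWithin_iff.1 (hb' (1 / 2) (by norm_num))
  have h2 : ∀ᶠ s : ℝ in 𝓝[>] 0, b + (1 / 2 : ℝ) * R.vec d + s * I ∈ R.region := by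
    filter_upwards [(tendsto_add_mul_I _ I).eventually h1, self_mem_nhdsWithin] with s hs hs0
    exact hs (add_mul_I_mem_leftHalf hd b _ hs0)
  obtain ⟨s, hs, hs'⟩ := mem_nhdsGT_iff_exists_Ioc_subset.1 h2
  exact ⟨_, b, hd, hb, 1 / 2, by norm_num, s, hs, rfl, hs'⟩

/-- The Euler characteristic of the region, computed by sweeping with a vertical line. -/
theorem card_floorSide [Finite D] {next : D → D} (hn : ∀ d, R.IsNext d (next d)) :
    Nat.card {d // R.IsFloorSide d} = Nat.card {d // R.IsUpSide next d} + 1 := by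
  classical
  have := Fintype.ofFinite {d // R.IsFloorSide d}
  have := Fintype.ofFinite {d // R.IsUpSide next d}
  have hfl := fun c : {d // R.IsUpSide next d} => exists_floors_of_upSide hn c.2
  choose p hp hcor r l br bl hbr hnear using hfl
  -- The coboundary of the graph whose vertices are the cells and whose edges are the walls: value
  -- on the right minus value on the left.
  let L : ({d // R.IsFloorSide d} → ℝ) →ₗ[ℝ] ({d // R.IsUpSide next d} → ℝ) :=
    LinearMap.pi fun c => LinearMap.proj (R := ℝ) (φ := fun _ => ℝ) (r c) -
      LinearMap.proj (R := ℝ) (φ := fun _ => ℝ) (l c)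
  have hL : ∀ a c, L a c = a (r c) - a (l c) := fun a c => rfl
  -- the kernel
  have hloc : ∀ a, L a = 0 → ∀ z₀ ∈ R.region, ∃ t : ℝ, ∀ᶠ z in 𝓝 z₀, z.re ≠ z₀.re →
      ∃ d b, R.Floor z d.1 b ∧ a d = t := by
    intro a ha z₀ hz₀
    rcases floor_or_above hz₀ with ⟨d, b, hf⟩ | ⟨v, q, hq, hab⟩
    · refine ⟨a ⟨d, hf.isFloorSide⟩, ?_⟩
      have := Floor.eventually hf
      filter_upwards [this] with z hz _ using ⟨⟨d, hf.isFloorSide⟩, b, hz, rfl⟩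
    · have hup : ∀ᶠ s : ℝ in 𝓝[>] 0, q + s * I ∈ R.region := by
        obtain ⟨s, hs, -, h⟩ := hab
        filter_upwards [Ioc_mem_nhdsGT hs] with s' hs' using h s' hs'
      obtain ⟨d, hdv, hdup, hdcor⟩ := exists_upCorner hn hq hup.frequently
      have hq' : q ∈ R.lift (R.src (R.rev d)) := hdv ▸ hq
      have hside := (hasCorner_iff_isSide_left (hn d) hq').1 hdcor
      let c : {d // R.IsUpSide next d} := ⟨d, ⟨_, hside⟩, hdup⟩
      have hpc : p c = q := by
        have h1 := (hasCorner_iff_isSide_left (hn d) (hp c)).1 (hcor c)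
        exact sub_left_injective (h1.unique hside)
      refine ⟨a (r c), ?_⟩
      have h2 := hnear c z₀ (hpc ▸ hab)
      rw [hpc, ← hab.re_eq] at h2
      filter_upwards [h2] with z hz hne
      rcases lt_or_gt_of_ne hne with h | h
      · refine ⟨l c, bl c, hz.2 h, ?_⟩
        have := congrFun ha c
        rw [hL] at this
        simp only [Pi.zero_apply] at this
        linarith
      · exact ⟨r c, br c, hz.1 h, rfl⟩
  have hne : ∀ z₀ z₁ : ℂ, ∃ᶠ z : ℂ in 𝓝 z₁, z.re ≠ z₀.re ∧ z.re ≠ z₁.re := by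
    intro z₀ z₁
    rcases le_or_gt z₀.re z₁.re with h | h
    · exact (frequently_re_gt z₁).mono fun z hz => ⟨(h.trans_lt hz).ne', hz.ne'⟩
    · exact (frequently_re_lt z₁).mono fun z hz => ⟨(hz.trans h).ne, hz.ne⟩
  have hconst : ∀ a, L a = 0 → ∃ t : ℝ, ∀ d, a d = t := by
    intro a ha
    choose! t ht using hloc a ha
    have hval : ∀ z d b, R.Floor z d.1 b → a d = t z := by
      intro z d b hf
      have := Floor.eventually hf
      obtain ⟨z', ⟨-, h1⟩, h2, h3⟩ :=
        ((hne z z).and_eventually (this.and (ht z hf.mem_region))).exists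
      obtain ⟨d', b', hf', he⟩ := h3 h1
      rw [← he, Subtype.ext (h2.unique hf').1]
    obtain ⟨w, hw⟩ := R.nonempty
    refine ⟨t w, fun d => ?_⟩
    obtain ⟨z, b, hf⟩ := d.2.exists_floor
    rw [hval z d b hf]
    refine R.preconnected.eq_of_eventually_eq (fun x hx => ?_) hf.mem_region hw
    rw [eventually_nhdsWithin_iff]
    filter_upwards [eventually_eventually_nhds.2 (ht x hx)] with y hy hyr
    obtain ⟨z', ⟨h1, h2⟩, h3, h4⟩ :=
      ((hne x y).and_eventually (hy.and (ht y hyr))).exists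
    obtain ⟨d₁, b₁, hf₁, he₁⟩ := h3 h1
    obtain ⟨d₂, b₂, hf₂, he₂⟩ := h4 h2
    rw [← he₁, ← he₂, Subtype.ext (hf₁.unique hf₂).1]
  have hnonempty : Nonempty {d // R.IsFloorSide d} := by
    obtain ⟨w, hw⟩ := R.nonempty
    obtain ⟨t, ht⟩ := hloc 0 (map_zero L) w hw
    obtain ⟨z, ⟨-, h1⟩, h2⟩ := ((hne w w).and_eventually ht).exists
    exact ⟨(h2 h1).choose⟩
  have hker : Module.finrank ℝ (LinearMap.ker L) = 1 := by
    have hspan : LinearMap.ker L = Submodule.span ℝ {fun _ => (1 : ℝ)} := by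
      ext a
      rw [LinearMap.mem_ker, Submodule.mem_span_singleton]
      constructor
      · intro ha
        obtain ⟨t, ht⟩ := hconst a ha
        exact ⟨t, funext fun d => by simp [ht]⟩
      · rintro ⟨t, rfl⟩
        ext c
        simp [hL]
    rw [hspan, finrank_span_singleton]
    intro h
    simpa using congrFun h hnonempty.some
  -- the range
  have hsurj : Function.Surjective L := by
    -- Walls are ordered from left to right. For the wall at `c`, the jump function is read off on
    -- the cells to the left of `p c` where possible: this gives a nonzero difference at `c` and
    -- none at walls further left.
    refine LinearMap.surjective_of_triangular L (fun c => (p c).re) ?_ ?_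
    · intro c c' hcc
      have h1 : p c = p c' := R.re_inj _ _ _ (hp c) _ (hp c') hcc
      have h2 : R.src (R.rev c.1) = R.src (R.rev c'.1) :=
        R.lift_inj _ _ (p c) (hp c) (h1 ▸ hp c')
      exact Subtype.ext (c.2.2.unique (hn _) (hn _) c'.2.2 h2)
    · intro c
      obtain ⟨F, hF, hjump⟩ := exists_jump_function (hp c)
      have hoff : ∀ z : ℂ, z.re ≠ (p c).re → ∀ s : ℝ, 0 ≤ s → z ≠ p c + s * I := by
        rintro z hz s - rfl
        simp at hz
      have hconstF : ∀ d b J, Set.OrdConnected J →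
          (∀ z, R.Floor z d b → z.re ∈ J → ∀ s : ℝ, 0 ≤ s → z ≠ p c + s * I) →
          ∀ z z', R.Floor z d b → z.re ∈ J → R.Floor z' d b → z'.re ∈ J → F z = F z' := by
        intro d b J hJ hray z z' hz hzJ hz' hzJ'
        refine (isPreconnected_floor d b hJ).eq_of_eventually_eq (fun x hx => ?_)
          ⟨hz, hzJ⟩ ⟨hz', hzJ'⟩
        exact nhdsWithin_le_nhds (hF x hx.1.mem_region (hray x hx.1 hx.2))
      let a : {d // R.IsFloorSide d} → ℝ := fun d =>
        if h : ∃ z b, R.Floor z d.1 b ∧ z.re < (p c).re then F h.choose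
        else F d.2.exists_floor.choose
      have haleft : ∀ (d : {d // R.IsFloorSide d}) z b, R.Floor z d.1 b → z.re < (p c).re →
          a d = F z := by
        intro d z b hf hz
        have h : ∃ z b, R.Floor z d.1 b ∧ z.re < (p c).re := ⟨z, b, hf, hz⟩
        simp only [a, dif_pos h]
        obtain ⟨b', hf', hz'⟩ := h.choose_spec
        obtain rfl : b = b' := hf.isSide.unique hf'.isSide
        exact hconstF d.1 b (Iio (p c).re) ordConnected_Iio
          (fun z _ hz => hoff z (ne_of_lt hz)) _ _ hf' hz' hf hz
      have haall : ∀ (d : {d // R.IsFloorSide d}) z b, R.Floor z d.1 b →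
          (∀ z, R.Floor z d.1 b → ∀ s : ℝ, 0 ≤ s → z ≠ p c + s * I) → a d = F z := by
        intro d z b hf hray
        have hz : ∃ z' b', R.Floor z' d.1 b' ∧ a d = F z' := by
          by_cases h : ∃ z b, R.Floor z d.1 b ∧ z.re < (p c).re
          · exact ⟨h.choose, h.choose_spec.choose, h.choose_spec.choose_spec.1, dif_pos h⟩
          · exact ⟨d.2.exists_floor.choose, d.2.exists_floor.choose_spec.choose,
              d.2.exists_floor.choose_spec.choose_spec, dif_neg h⟩
        obtain ⟨z', b', hf', he⟩ := hz
        obtain rfl : b = b' := hf.isSide.unique hf'.isSide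
        rw [he]
        exact hconstF d.1 b univ ordConnected_univ (fun z hz _ => hray z hz) _ _ hf' trivial hf
          trivial
      refine ⟨a, ?_, ?_⟩
      · obtain ⟨z₀, hz₀⟩ := (hcor c).exists_above c.2.2
        obtain ⟨U, hU, hU'⟩ := hjump z₀ hz₀
        have h1 := hnear c z₀ hz₀
        obtain ⟨z, hz1, hz2, hz3⟩ :=
          ((frequently_re_lt z₀).and_eventually (h1.and hU)).exists
        obtain ⟨z', hz1', hz2', hz3'⟩ :=
          ((frequently_re_gt z₀).and_eventually (h1.and hU)).exists
        rw [hz₀.re_eq] at hz1 hz1'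
        have hr := hz2'.1 hz1'
        -- The value on the right cell is unambiguous because the ray above `p c` does not meet that
        -- cell. Either its side starts at `p c`, or the side lies below `p c`, and a vertical from
        -- the side to the ray would pass through `p c`.
        rw [hL, haleft _ _ _ (hz2.2 hz1) hz1, haall (r c) z' (br c) hr, sub_ne_zero]
        · exact (hU' z hz3 z' hz3' hz1 hz1').symm
        · rcases hbr c with hb | ⟨q, hq1, hq2, hq3⟩
          · rintro _ ⟨hd, -, τ, hτ, s, -, rfl, -⟩
            apply hoff
            rw [hb]
            have := mul_pos hτ.1 hd
            simp only [Complex.add_re, Complex.re_ofReal_mul, Complex.I_re, mul_zero, add_zero]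
            linarith
          · rintro _ ⟨hd, hb, τ, hτ, s, hs, rfl, hseg⟩ s' hs' he
            obtain ⟨-, -, τ', hτ', t, ht, rfl, hseg'⟩ := hq3
            have hre := congrArg Complex.re he
            have him := congrArg Complex.im he
            simp at hre him hq1 hq2
            have hτ : τ = τ' := by
              have : τ * (R.vec (r c).1).re = τ' * (R.vec (r c).1).re := by linarith
              exact mul_right_cancel₀ hd.ne' this
            subst hτ
            have hmem := hseg (s - s') ⟨by linarith, by linarith⟩
            refine region_disjoint_graph hmem ?_
            convert mem_graph_of_mem_lift (hp c) using 1
            push_cast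
            linear_combination he
      · intro c' hlt
        obtain ⟨z₀, hz₀⟩ := (hcor c').exists_above c'.2.2
        have h1 := hnear c' z₀ hz₀
        have h2 := hF z₀ hz₀.mem_region (hoff z₀ (by rw [hz₀.re_eq]; exact hlt.ne))
        have h3 : ∀ᶠ z : ℂ in 𝓝 z₀, z.re < (p c).re :=
          Complex.continuous_re.continuousAt.eventually_lt_const (by rw [hz₀.re_eq]; exact hlt)
        obtain ⟨z, hz1, hz2, hz3, hz4⟩ :=
          ((frequently_re_lt z₀).and_eventually (h1.and (h2.and h3))).exists
        obtain ⟨z', hz1', hz2', hz3', hz4'⟩ :=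
          ((frequently_re_gt z₀).and_eventually (h1.and (h2.and h3))).exists
        rw [hz₀.re_eq] at hz1 hz1'
        rw [hL, haleft _ _ _ (hz2.2 hz1) hz4, haleft _ _ _ (hz2'.1 hz1') hz4', hz3, hz3', sub_self]
  have hrank := L.finrank_range_add_finrank_ker
  rw [LinearMap.range_eq_top.2 hsurj, finrank_top, hker, Module.finrank_fintype_fun_eq_card,
    Module.finrank_fintype_fun_eq_card] at hrank
  rw [Nat.card_eq_fintype_card, Nat.card_eq_fintype_card, hrank]

end PlanarRegion


/-! ### The angle sum of a face -/

theorem ccwAngle_I_of_re_pos {v : ℂ} (hv : 0 < v.re) :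
    ccwAngle I v = ccwAngle I (-v) + Real.pi := by
  have hv0 : -v ≠ 0 := by rw [neg_ne_zero]; rintro rfl; simp at hv
  have h1 : ccwAngle I (-v) < Real.pi := ccwAngle_I_left_lt_pi_iff.2 (by simpa using hv)
  have h0 := ccwAngle_pos I (-v)
  obtain ⟨r, hr, h⟩ := exists_eq_mul_exp_ccwAngle I_ne_zero hv0
  refine ccwAngle_eq I_ne_zero hr (by linarith [Real.pi_pos]) (by linarith) ?_
  push_cast
  rw [add_mul, Complex.exp_add, Complex.exp_pi_mul_I]
  linear_combination -h

/-- Opposite vectors differ by π in the branch cut along the vertical, and the rightward one has the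
larger angle. -/
theorem halfAngle_I_div_neg {v : ℂ} (hv : v.re ≠ 0) :
    halfAngle I v / halfAngle I (-v) = if 0 < v.re then I else -I := by
  have key : ∀ w : ℂ, 0 < w.re → halfAngle I w / halfAngle I (-w) = I := by
    intro w hw
    unfold halfAngle
    rw [← Complex.exp_sub, ccwAngle_I_of_re_pos hw]
    push_cast
    rw [show I / 2 * ((ccwAngle I (-w) : ℂ) + Real.pi - Real.pi) -
      I / 2 * (ccwAngle I (-w) - Real.pi) = Real.pi / 2 * I by ring,
      Complex.exp_pi_div_two_mul_I]
  rcases lt_or_gt_of_ne hv with h | h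
  · rw [if_neg (by linarith)]
    have := key (-v) (by simpa using h)
    rw [neg_neg] at this
    rw [← inv_div, this, Complex.inv_I]
  · rw [if_pos h, key v h]

namespace PlanarRegion

variable {V D : Type*} {R : PlanarRegion V D}

theorem IsSide.next {next : D → D} (hn : ∀ d, R.IsNext d (next d)) {d : D} {b : ℂ}
    (h : R.IsSide d b) : R.IsSide (next d) (b + R.vec d) := by
  have hp := R.lift_dst d b h.1
  rw [← hasCorner_iff_isSide_right (hn d) hp, hasCorner_iff_isSide_left (hn d) hp]
  simpa using h

open Classical in
/-- The angles of a face with `2 * m` sides have sum `(2 * m - 2) * π` modulo `4 * π`. -/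
theorem prod_exp_corner_angle [Finite D] {next : D → D} (hn : ∀ d, R.IsNext d (next d))
    (S : Finset D) (hS : ∀ d, d ∈ S ↔ ∃ b, R.IsSide d b) {m : ℕ} (hm : S.card = 2 * m) :
    ∏ d ∈ S, exp (-(I / 2) * ccwAngle (R.vec (next d)) (R.vec (R.rev d))) = (-1) ^ (m + 1) := by
  have hmaps : ∀ d ∈ S, next d ∈ S := by
    intro d hd
    obtain ⟨b, hb⟩ := (hS d).1 hd
    exact (hS _).2 ⟨_, hb.next hn⟩
  have hinj : Set.InjOn next S := fun a _ b _ hab => (hn a).left_unique (hab ▸ hn b)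
  -- This permutation turns the product over corners into a product over sides.
  have hprod : ∀ f : D → ℂ, ∏ d ∈ S, f (next d) = ∏ d ∈ S, f d := fun f =>
    Finset.prod_nbij next hmaps hinj (Finset.surjOn_of_injOn_of_card_le next hmaps hinj le_rfl)
      fun _ _ => rfl
  have hterm : ∀ d, exp (-(I / 2) * ccwAngle (R.vec (next d)) (R.vec (R.rev d))) =
      halfAngle I (R.vec (next d)) / halfAngle I (R.vec (R.rev d)) *
        if R.IsUpCorner d (next d) then -1 else 1 := by
    intro d
    rw [halfAngle_div_halfAngle (vec_ne_zero _) (vec_ne_zero _) I_ne_zero, mul_assoc]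
    have hne : ccwAngle (R.vec (next d)) I ≠ 2 * Real.pi := by
      rw [Ne, ccwAngle_eq_two_pi_iff (vec_ne_zero _) I_ne_zero]
      rintro ⟨r, hr, h⟩
      have h2 := congrArg Complex.re h
      simp at h2
      rcases h2 with h2 | h2
      · exact hr.ne' h2
      · exact R.vec_re_ne _ h2
    simp only [hne, or_false, IsUpCorner]
    by_cases h : ccwAngle (R.vec (next d)) I < ccwAngle (R.vec (next d)) (R.vec (R.rev d)) <;>
      simp [h]
  have hcardF : (S.filter fun d => 0 < (R.vec d).re).card = Nat.card {d // R.IsFloorSide d} := by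
    rw [← Nat.card_eq_finsetCard]
    refine Nat.card_congr (Equiv.subtypeEquivRight fun d => ?_)
    rw [Finset.mem_filter, hS, IsFloorSide]
  have hcardU : (S.filter fun d => R.IsUpCorner d (next d)).card =
      Nat.card {d // R.IsUpSide next d} := by
    rw [← Nat.card_eq_finsetCard]
    refine Nat.card_congr (Equiv.subtypeEquivRight fun d => ?_)
    rw [Finset.mem_filter, hS, IsUpSide]
  have hFU := card_floorSide hn
  rw [← hcardF, ← hcardU] at hFU
  have hsplit := S.card_filter_add_card_filter_not (fun d => 0 < (R.vec d).re)
  rw [hm] at hsplit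
  rw [Finset.prod_congr rfl fun d _ => hterm d, Finset.prod_mul_distrib, Finset.prod_div_distrib,
    hprod fun d => halfAngle I (R.vec d), ← Finset.prod_div_distrib]
  have h1 : ∀ d, halfAngle I (R.vec d) / halfAngle I (R.vec (R.rev d)) =
      if 0 < (R.vec d).re then I else -I := by
    intro d
    rw [R.vec_rev, halfAngle_I_div_neg (R.vec_re_ne d)]
  rw [Finset.prod_congr rfl fun d _ => h1 d, Finset.prod_ite, Finset.prod_ite,
    Finset.prod_const, Finset.prod_const, Finset.prod_const, Finset.prod_const, one_pow, mul_one]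
  generalize (S.filter fun d => 0 < (R.vec d).re).card = F at *
  generalize (S.filter fun d => ¬ 0 < (R.vec d).re).card = N at *
  generalize (S.filter fun d => R.IsUpCorner d (next d)).card = U at *
  subst hFU
  have hI : (I : ℂ) ^ (2 * m) = (-1) ^ m := by rw [pow_mul, Complex.I_sq]
  rw [neg_pow I N]
  calc I ^ (U + 1) * ((-1) ^ N * I ^ N) * (-1) ^ U
      = I ^ (U + 1 + N) * (-1) ^ (N + U) := by rw [pow_add _ (U + 1), pow_add (-1 : ℂ)]; ring
    _ = (-1) ^ m * (-1) ^ (N + U) := by rw [hsplit, hI]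
    -- With F = U + 1 and F + N = 2m, the exponent N + U is 2m - 1.
    _ = (-1) ^ (m + 1) := by
      have h2 : ((-1 : ℂ)) ^ (N + U) = -1 := by
        rw [Odd.neg_one_pow]
        exact ⟨m - 1, by omega⟩
      rw [h2, pow_succ]

end PlanarRegion


/-! ### Coverings and the lifted drawing -/

/-- A map from a contractible space lifts through a surjective covering map. -/
theorem IsCoveringMap.exists_lift {A X E : Type*} [TopologicalSpace A] [TopologicalSpace X]
    [TopologicalSpace E] [ContractibleSpace A] {p : E → X} (hp : IsCoveringMap p)
    (hs : Function.Surjective p) (f : C(A, X)) : ∃ F : C(A, E), ∀ a, p (F a) = f a := by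
  obtain ⟨a₀, ⟨H⟩⟩ := id_nullhomotopic A
  obtain ⟨e, he⟩ := hs (f a₀)
  -- A homotopy from a constant map to `f`: its start lifts trivially, and its lift at time 1 is the
  -- required map.
  let K : C(unitInterval × A, X) := f.comp H.symm.toContinuousMap
  have hK0 : ∀ a, K (0, a) = p (ContinuousMap.const A e a) := by
    intro a
    change f (H.symm (0, a)) = p e
    rw [H.symm.apply_zero, he]; rfl
  let G := hp.liftHomotopy K (ContinuousMap.const A e) hK0
  refine ⟨G.comp ((ContinuousMap.const A 1).prodMk (ContinuousMap.id A)), fun a => ?_⟩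
  have h1 := congrFun (hp.liftHomotopy_lifts K (ContinuousMap.const A e) hK0) (1, a)
  change p (G (1, a)) = f a
  refine Eq.trans h1 ?_
  change f (H.symm (1, a)) = f a
  rw [H.symm.apply_one]; rfl

/-- The covering of the flat torus by the plane, rotated and scaled by `κ`. -/
def torusCover (Λ : Submodule ℤ ℂ) (κ z : ℂ) : FlatTorus Λ := QuotientAddGroup.mk (κ * z)

section Cover

variable {Λ : Submodule ℤ ℂ} {κ : ℂ}

theorem torusCover_add (z w : ℂ) :
    torusCover Λ κ (z + w) = torusCover Λ κ z + torusCover Λ κ w := by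
  unfold torusCover; rw [mul_add]; rfl

theorem torusCover_eq_iff {z w : ℂ} : torusCover Λ κ z = torusCover Λ κ w ↔ κ * (w - z) ∈ Λ := by
  unfold torusCover
  rw [QuotientAddGroup.eq, mul_sub, Submodule.mem_toAddSubgroup, neg_add_eq_sub]

theorem torusCover_surjective (hκ : κ ≠ 0) : Function.Surjective (torusCover Λ κ) := by
  intro x
  obtain ⟨w, rfl⟩ := QuotientAddGroup.mk_surjective x
  exact ⟨w / κ, by unfold torusCover; rw [mul_div_cancel₀ _ hκ]⟩

theorem isCoveringMap_torusCover [DiscreteTopology Λ] (hκ : κ ≠ 0) :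
    IsCoveringMap (torusCover Λ κ) := by
  have h1 : IsCoveringMap (QuotientAddGroup.mk : ℂ → FlatTorus Λ) :=
    (Λ.toAddSubgroup.isAddQuotientCoveringMap_of_comm
      (DiscreteTopology.isDiscrete (s := (Λ : Set ℂ)))).isCoveringMap
  exact h1.comp_homeomorph (Homeomorph.mulLeft₀ κ hκ)

theorem finite_lattice_ball [DiscreteTopology Λ] (hκ : κ ≠ 0) (x : FlatTorus Λ) (p : ℂ) (r : ℝ) :
    {z | torusCover Λ κ z = x ∧ ‖z - p‖ ≤ r}.Finite := by
  obtain ⟨b, rfl⟩ := torusCover_surjective hκ x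
  have hclosed : IsClosed (Λ : Set ℂ) := by
    have : DiscreteTopology Λ.toAddSubgroup := ‹_›
    exact AddSubgroup.isClosed_of_discrete (H := Λ.toAddSubgroup)
  have hfin : (Metric.closedBall (κ * (b - p)) (‖κ‖ * r) ∩ (Λ : Set ℂ)).Finite :=
    Metric.finite_isBounded_inter_isClosed (DiscreteTopology.isDiscrete (s := (Λ : Set ℂ)))
      Metric.isBounded_closedBall hclosed
  refine (hfin.preimage (f := fun z => κ * (b - z)) ?_).subset ?_
  · intro z _ w _ h
    have := mul_left_cancel₀ hκ h
    exact sub_right_injective this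
  · rintro z ⟨h1, h2⟩
    refine ⟨?_, torusCover_eq_iff.1 h1⟩
    rw [Metric.mem_closedBall, dist_eq_norm, ← mul_sub, norm_mul]
    gcongr
    rw [sub_sub_sub_cancel_left, norm_sub_rev]
    exact h2

theorem exists_bounded_fundamental [DiscreteTopology Λ] [IsZLattice ℝ Λ] :
    ∃ C : ℝ, ∀ z : ℂ, ∃ l ∈ Λ, ‖z - l‖ ≤ C := by
  have : Module.Free ℤ Λ := ZLattice.module_free ℝ Λ
  have : Module.Finite ℤ Λ := ZLattice.module_finite ℝ Λ
  let b := (Module.Free.chooseBasis ℤ Λ).ofZLatticeBasis ℝ Λ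
  have hb : Submodule.span ℤ (Set.range b) = Λ := Module.Basis.ofZLatticeBasis_span ..
  refine ⟨∑ i, ‖b i‖, fun z => ⟨ZSpan.floor b z, ?_, ?_⟩⟩
  · have := (ZSpan.floor b z).2
    exact hb.le this
  · exact ZSpan.norm_fract_le b z

/-- A vertical ray in the torus comes back arbitrarily close to its origin. -/
theorem exists_return [DiscreteTopology Λ] [IsZLattice ℝ Λ] (hκ : κ ≠ 0) {r : ℝ} (hr : 0 < r) :
    ∃ n : ℕ, 0 < n ∧ ∃ w : ℂ, ‖w‖ < r ∧ torusCover Λ κ (-(n * I)) = torusCover Λ κ w := by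
  obtain ⟨C, hC⟩ := exists_bounded_fundamental (Λ := Λ)
  -- Reduced modulo the lattice, the points at heights -n are bounded, so two of them are close;
  -- their difference is the return.
  choose l hl hlC using fun n : ℕ => hC (κ * (-(n * I)))
  obtain ⟨a, -, φ, hφ, ha⟩ := tendsto_subseq_of_bounded (Metric.isBounded_closedBall
    (x := (0 : ℂ)) (r := C)) (fun n => by simpa using hlC n)
  have hcau := ha.cauchySeq
  obtain ⟨N, hN⟩ := Metric.cauchySeq_iff.1 hcau (‖κ‖ * r) (by positivity)
  have h1 := hN (N + 1) (by omega) N le_rfl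
  have h2 : φ N < φ (N + 1) := hφ (by omega)
  refine ⟨φ (N + 1) - φ N, by omega, ((κ * (-(φ (N + 1) * I)) - l (φ (N + 1))) -
    (κ * (-(φ N * I)) - l (φ N))) / κ, ?_, ?_⟩
  · rw [norm_div, div_lt_iff₀ (norm_pos_iff.2 hκ), mul_comm r, ← dist_eq_norm]
    simpa using h1
  · rw [torusCover_eq_iff]
    have : κ * (((κ * (-(φ (N + 1) * I)) - l (φ (N + 1))) -
        (κ * (-(φ N * I)) - l (φ N))) / κ - -(((φ (N + 1) - φ N : ℕ) : ℂ) * I)) =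
        l (φ N) - l (φ (N + 1)) := by
      rw [Nat.cast_sub h2.le]
      field_simp
      ring
    rw [this]
    exact Λ.sub_mem (hl _) (hl _)

end Cover

namespace StraightGraph

variable {Λ : Submodule ℤ ℂ} {W B E : Type*} (G : StraightGraph Λ W B E)

/-- The opposite dart. -/
def dartRev (d : E × Bool) : E × Bool := (d.1, !d.2)

variable {G}

theorem dartRev_dartRev (d : E × Bool) : dartRev (dartRev d) = d := by
  simp [dartRev]

theorem dartSrc_dartRev (d : E × Bool) : G.dartSrc (dartRev d) = G.dartDst d := by
  rcases d with ⟨e, _ | _⟩ <;> simp [dartSrc, dartDst, dartRev]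

theorem dartVec_dartRev (d : E × Bool) : G.dartVec (dartRev d) = -G.dartVec d := by
  rcases d with ⟨e, _ | _⟩ <;> simp [dartVec, dartRev]

theorem pos_dartDst (d : E × Bool) : G.pos (G.dartDst d) =
    G.pos (G.dartSrc d) + (QuotientAddGroup.mk (G.dartVec d) : FlatTorus Λ) := by
  rcases d with ⟨e, _ | _⟩
  · simp [dartSrc, dartDst, dartVec, G.pos_black]
  · simp [dartSrc, dartDst, dartVec, G.pos_black]

theorem pos_add_dartVec (d : E × Bool) (t : ℝ) :
    G.pos (G.dartSrc d) + (QuotientAddGroup.mk (t * G.dartVec d) : FlatTorus Λ) =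
      G.edgePoint d.1 (if d.2 then t else 1 - t) := by
  rcases d with ⟨e, _ | _⟩
  · simp only [dartSrc, dartVec, edgePoint, G.pos_black, Bool.false_eq_true, if_false]
    rw [add_assoc, ← QuotientAddGroup.mk_add]
    congr 2
    push_cast; ring
  · simp [dartSrc, dartVec, edgePoint]

theorem edgePoint_mem_support (e : E) {t : ℝ} (ht : t ∈ Icc (0 : ℝ) 1) :
    G.edgePoint e t ∈ G.support := Or.inr (mem_iUnion.2 ⟨e, t, ht, rfl⟩)

theorem exists_dart (o : G.PerfectOrientation) (v : W ⊕ B) : ∃ d, G.dartSrc d = v := by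
  rcases v with w | b
  · obtain ⟨e, ⟨h, -⟩, -⟩ := o.existsUnique_in w
    exact ⟨(e, true), by simp [dartSrc, h]⟩
  · obtain ⟨e, ⟨h, -⟩, -⟩ := o.existsUnique_out b
    exact ⟨(e, false), by simp [dartSrc, h]⟩

theorem dartVec_ne_zero (hG : G.IsToric) (d : E × Bool) : G.dartVec d ≠ 0 := by
  intro h
  have h1 := G.pos_dartDst d
  rw [h, QuotientAddGroup.mk_zero, add_zero] at h1
  have h2 := hG.pos_injective h1
  rcases d with ⟨e, _ | _⟩ <;> simp [dartSrc, dartDst] at h2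

variable {κ : ℂ}

theorem torusCover_add_dartVec (hκ : κ ≠ 0) {d : E × Bool} {b : ℂ}
    (hb : torusCover Λ κ b = G.pos (G.dartSrc d)) (t : ℝ) :
    torusCover Λ κ (b + t * (G.dartVec d / κ)) = G.edgePoint d.1 (if d.2 then t else 1 - t) := by
  rw [← pos_add_dartVec, torusCover_add, hb]
  congr 1
  unfold torusCover
  congr 1
  field_simp

theorem torusCover_add_dartVec_dst (hκ : κ ≠ 0) {d : E × Bool} {b : ℂ}
    (hb : torusCover Λ κ b = G.pos (G.dartSrc d)) :
    torusCover Λ κ (b + G.dartVec d / κ) = G.pos (G.dartDst d) := by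
  rw [pos_dartDst, torusCover_add, hb]
  congr 1
  unfold torusCover
  congr 1
  field_simp

theorem ite_mem_Icc (c : Bool) {t : ℝ} (ht : t ∈ Icc (0 : ℝ) 1) :
    (if c then t else 1 - t) ∈ Icc (0 : ℝ) 1 := by
  split_ifs
  · exact ht
  · exact ⟨by linarith [ht.2], by linarith [ht.1]⟩

theorem ite_mem_Ioo (c : Bool) {t : ℝ} (ht : t ∈ Ioo (0 : ℝ) 1) :
    (if c then t else 1 - t) ∈ Ioo (0 : ℝ) 1 := by
  split_ifs
  · exact ht
  · exact ⟨by linarith [ht.2], by linarith [ht.1]⟩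

/-- The points over the graph are those on the lifted darts. -/
theorem torusCover_mem_support_iff (o : G.PerfectOrientation) (hκ : κ ≠ 0) {z : ℂ} :
    torusCover Λ κ z ∈ G.support ↔ ∃ d, ∃ b, torusCover Λ κ b = G.pos (G.dartSrc d) ∧
      ∃ t ∈ Icc (0 : ℝ) 1, z = b + t * (G.dartVec d / κ) := by
  constructor
  · rintro (⟨v, hv⟩ | h)
    · obtain ⟨d, rfl⟩ := exists_dart o v
      exact ⟨d, z, hv.symm, 0, by simp, by simp⟩
    · obtain ⟨e, t, ht, he⟩ := mem_iUnion.1 h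
      refine ⟨(e, true), z - t * (G.dartVec (e, true) / κ), ?_, t, ht, by ring⟩
      have h1 : torusCover Λ κ (z - t * (G.dartVec (e, true) / κ)) +
          torusCover Λ κ (t * (G.dartVec (e, true) / κ)) = torusCover Λ κ z := by
        rw [← torusCover_add]; congr 1; ring
      have h2 : torusCover Λ κ (t * (G.dartVec (e, true) / κ)) =
          (QuotientAddGroup.mk ((t : ℂ) * G.vec e) : FlatTorus Λ) := by
        unfold torusCover
        congr 1
        simp only [dartVec, if_true]
        field_simp
      rw [h2, ← he] at h1
      exact add_right_cancel h1
  · rintro ⟨d, b, hb, t, ht, rfl⟩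
    rw [torusCover_add_dartVec hκ hb]
    exact edgePoint_mem_support _ (ite_mem_Icc _ ht)

/-- Only finitely many lifted edges come within distance 1 of `p`, and those that avoid `p` form a
closed set. -/
theorem exists_ball_torusCover [Finite E] [DiscreteTopology Λ] (hκ : κ ≠ 0) (p : ℂ) :
    ∃ ε > 0, ∀ z ∈ Metric.ball p ε,
    (∃ d, ∃ b, torusCover Λ κ b = G.pos (G.dartSrc d) ∧
      ∃ t ∈ Icc (0 : ℝ) 1, z = b + t * (G.dartVec d / κ)) →
      ∃ d, ∃ b, torusCover Λ κ b = G.pos (G.dartSrc d) ∧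
        ∃ t ∈ Icc (0 : ℝ) 1, ∃ t₀ ∈ Icc (0 : ℝ) 1,
        z = b + t * (G.dartVec d / κ) ∧ p = b + t₀ * (G.dartVec d / κ) := by
  let S : E × Bool → ℂ → Set ℂ := fun d b => (fun t : ℝ => b + t * (G.dartVec d / κ)) '' Icc 0 1
  have hS : ∀ d b, IsClosed (S d b) := fun d b =>
    (isCompact_Icc.image (by fun_prop)).isClosed
  have h1 : ∀ d, ∀ᶠ z in 𝓝 p, ∀ b ∈ {b | torusCover Λ κ b = G.pos (G.dartSrc d) ∧
      ‖b - p‖ ≤ 1 + ‖G.dartVec d / κ‖}, z ∈ S d b → p ∈ S d b := by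
    intro d
    rw [(finite_lattice_ball hκ (G.pos (G.dartSrc d)) p _).eventually_all]
    intro b _
    by_cases hp : p ∈ S d b
    · exact Eventually.of_forall fun _ _ => hp
    · filter_upwards [(hS d b).isOpen_compl.mem_nhds hp] with z hz hz'
      exact absurd hz' hz
  obtain ⟨ε, hε, h⟩ := Metric.eventually_nhds_iff_ball.1 (eventually_all.2 h1)
  refine ⟨min ε 1, by positivity, ?_⟩
  rintro z hz ⟨d, b, hb, t, ht, rfl⟩
  have hz1 := Metric.ball_subset_ball (min_le_left ε 1) hz
  have hz2 := Metric.ball_subset_ball (min_le_right ε 1) hz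
  rw [Metric.mem_ball, dist_eq_norm] at hz2
  have hbp : ‖b - p‖ ≤ 1 + ‖G.dartVec d / κ‖ := by
    calc ‖b - p‖ = ‖(b + t * (G.dartVec d / κ) - p) - t * (G.dartVec d / κ)‖ := by
          congr 1; ring
      _ ≤ ‖b + t * (G.dartVec d / κ) - p‖ + ‖t * (G.dartVec d / κ)‖ := norm_sub_le _ _
      _ ≤ 1 + ‖G.dartVec d / κ‖ := by
        rw [norm_mul, Complex.norm_real, Real.norm_of_nonneg ht.1]
        have := mul_le_of_le_one_left (norm_nonneg (G.dartVec d / κ)) ht.2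
        linarith
  obtain ⟨t₀, ht₀, he⟩ := h _ hz1 d b ⟨hb, hbp⟩ ⟨t, ht, rfl⟩
  exact ⟨d, b, hb, t, ht, t₀, ht₀, rfl, he.symm⟩

end StraightGraph


/-! ### The lift of a face as a planar region -/

namespace StraightGraph

variable {Λ : Submodule ℤ ℂ} {W B E : Type*} {G : StraightGraph Λ W B E} {κ : ℂ}
  {f : Set (FlatTorus Λ)}

theorem IsFace.disjoint_support (hf : G.IsFace f) {x : FlatTorus Λ} (hx : x ∈ f) :
    x ∉ G.support := by
  obtain ⟨x₀, -, rfl⟩ := hf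
  exact connectedComponentIn_subset _ _ hx

theorem IsFace.subset (hf : G.IsFace f) {C : Set (FlatTorus Λ)} (hC : IsPreconnected C)
    (hd : ∀ x ∈ C, x ∉ G.support) (hne : (C ∩ f).Nonempty) : C ⊆ f := by
  obtain ⟨x₀, -, rfl⟩ := hf
  obtain ⟨x, hxC, hx⟩ := hne
  rw [connectedComponentIn_eq hx]
  exact hC.subset_connectedComponentIn hxC hd

/-- On a connected set over the face, the inclusion and the composite of the projection with `F` are
two lifts of the same map. They agree at one point, hence everywhere. -/
theorem IsFace.subset_range_lift [DiscreteTopology Λ] (hκ : κ ≠ 0) (hf : G.IsFace f)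
    {F : C(f, ℂ)} (hF : ∀ x, torusCover Λ κ (F x) = x) {C : Set ℂ} (hC : IsPreconnected C)
    (hd : ∀ z ∈ C, torusCover Λ κ z ∉ G.support) (hne : (C ∩ range F).Nonempty) :
    C ⊆ range F := by
  have hcov := isCoveringMap_torusCover (Λ := Λ) hκ
  obtain ⟨_, hz₀, x, rfl⟩ := hne
  have hmem : ∀ z ∈ C, torusCover Λ κ z ∈ f := by
    have := hf.subset (hC.image _ hcov.continuous.continuousOn)
      (by rintro _ ⟨z, hz, rfl⟩; exact hd z hz)
      ⟨x, ⟨F x, hz₀, hF x⟩, x.2⟩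
    exact fun z hz => this ⟨z, hz, rfl⟩
  have : PreconnectedSpace C := Subtype.preconnectedSpace hC
  have h1 : Continuous fun z : C => F ⟨torusCover Λ κ z, hmem z z.2⟩ :=
    F.continuous.comp ((hcov.continuous.comp continuous_subtype_val).subtype_mk _)
  have h2 := hcov.eq_of_comp_eq h1 continuous_subtype_val
    (funext fun z => by simp [hF]) ⟨F x, hz₀⟩ (by
      simp only
      congr 1
      exact Subtype.ext (hF x))
  intro z hz
  exact ⟨_, congrFun h2 ⟨z, hz⟩⟩

theorem eq_of_mem_range_lift {F : C(f, ℂ)} (hF : ∀ x, torusCover Λ κ (F x) = x) {z w : ℂ}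
    (hz : z ∈ range F) (hw : w ∈ range F) (h : torusCover Λ κ z = torusCover Λ κ w) : z = w := by
  obtain ⟨x, rfl⟩ := hz
  obtain ⟨y, rfl⟩ := hw
  rw [hF, hF] at h
  rw [Subtype.ext h]

/-- No lifted edge is vertical, and no two lifted vertices are on the same vertical line. -/
def IsGenericDirection (G : StraightGraph Λ W B E) (κ : ℂ) : Prop :=
  κ ≠ 0 ∧ ∀ v w p q, torusCover Λ κ p = G.pos v → torusCover Λ κ q = G.pos w → p.re = q.re → p = q

theorem dartVec_div_re_ne (hG : G.IsToric) (hκ : G.IsGenericDirection κ) (d : E × Bool) :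
    (G.dartVec d / κ).re ≠ 0 := by
  intro h
  obtain ⟨p, hp⟩ := torusCover_surjective hκ.1 (G.pos (G.dartSrc d))
  have h1 := hκ.2 _ _ _ _ hp (torusCover_add_dartVec_dst hκ.1 hp) (by simp [h])
  have h2 : G.dartVec d / κ = 0 := by simpa using h1
  rw [div_eq_zero_iff] at h2
  exact h2.elim (dartVec_ne_zero hG d) hκ.1

/-- The lift of a face to the plane. -/
def liftedFace [Fintype E] [DiscreteTopology Λ] [IsZLattice ℝ Λ] (hG : G.IsToric)
    (o : G.PerfectOrientation) (hκ : G.IsGenericDirection κ) (hf : G.IsFace f)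
    (F : C(f, ℂ)) (hF : ∀ x, torusCover Λ κ (F x) = x) :
    PlanarRegion (W ⊕ B) (E × Bool) where
  src := G.dartSrc
  rev := dartRev
  vec d := G.dartVec d / κ
  lift v := {z | torusCover Λ κ z = G.pos v}
  region := range F
  rev_rev := dartRev_dartRev
  vec_rev d := by rw [dartVec_dartRev, neg_div]
  vec_re_ne := dartVec_div_re_ne hG hκ
  exists_dart := exists_dart o
  lift_dst d p hp := by
    rw [dartSrc_dartRev]
    exact torusCover_add_dartVec_dst hκ.1 hp
  lift_src d p hp := by
    have := torusCover_add_dartVec_dst hκ.1 hp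
    rwa [dartVec_dartRev, neg_div, ← sub_eq_add_neg, ← dartSrc_dartRev, dartRev_dartRev] at this
  lift_inj v w p hp hp' := hG.pos_injective (hp.symm.trans hp')
  lift_nonempty v := torusCover_surjective hκ.1 _
  re_inj v w p hp q hq h := hκ.2 v w p q hp hq h
  exists_ball := exists_ball_torusCover hκ.1
  edge_ne_vertex d b hb t ht v h := by
    have h1 := torusCover_add_dartVec hκ.1 hb t
    exact hG.edgePoint_ne_pos d.1 _ (ite_mem_Ioo d.2 ht) v (h1.symm.trans h)
  edge_inj d d' b hb b' hb' t ht t' ht' h := by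
    have h1 := torusCover_add_dartVec hκ.1 hb t
    have h2 := torusCover_add_dartVec hκ.1 hb' t'
    rw [h, h2] at h1
    obtain ⟨h3, h4⟩ := hG.edgePoint_injective _ _ _ (ite_mem_Ioo d'.2 ht') _ (ite_mem_Ioo d.2 ht) h1
    by_cases hd : d'.2 = d.2
    · have hdd : d' = d := Prod.ext h3 hd
      subst hdd
      have : t' = t := by split_ifs at h4 <;> linarith
      subst this
      exact Or.inl ⟨rfl, (add_right_cancel h).symm⟩
    · have hdd : d' = dartRev d := Prod.ext h3 (Bool.eq_not.2 hd)
      have ht1 : t' = 1 - t := by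
        subst hdd
        rcases d with ⟨e, _ | _⟩ <;> simp [dartRev] at h4 <;> linarith
      refine Or.inr ⟨hdd, ?_⟩
      rw [hdd, dartVec_dartRev, ht1] at h
      push_cast at h
      linear_combination -h
  nonempty := by
    obtain ⟨x₀, hx₀, rfl⟩ := hf
    exact ⟨_, ⟨x₀, mem_connectedComponentIn hx₀⟩, rfl⟩
  preconnected := by
    have hp : IsPreconnected f := by
      obtain ⟨x₀, hx₀, rfl⟩ := hf
      exact isPreconnected_connectedComponentIn
    have : PreconnectedSpace f := Subtype.preconnectedSpace hp
    exact isPreconnected_range F.continuous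
  region_disjoint d b hb t ht := by
    rintro ⟨x, hx⟩
    refine hf.disjoint_support x.2 ?_
    rw [← hF x, hx, torusCover_mem_support_iff o hκ.1]
    exact ⟨d, b, hb, t, ht, rfl⟩
  maximal C hC hd hne := by
    refine hf.subset_range_lift hκ.1 hF hC (fun z hz h => ?_) hne
    obtain ⟨d, b, hb, t, ht, rfl⟩ := (torusCover_mem_support_iff o hκ.1).1 h
    exact hd d b hb t ht hz
  exists_notMem_below z hz := by
    by_contra! hcon
    have hnear : ∃ ε > 0, Metric.ball z ε ⊆ range F := by
      obtain ⟨ε, hε, h⟩ := exists_ball_torusCover (G := G) hκ.1 z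
      refine ⟨ε, hε, hf.subset_range_lift hκ.1 hF (convex_ball z ε).isPreconnected
        (fun w hw hws => ?_) ⟨z, Metric.mem_ball_self hε, hz⟩⟩
      obtain ⟨d, b, hb, t, ht, t₀, ht₀, -, h₀⟩ :=
        h w hw ((torusCover_mem_support_iff o hκ.1).1 hws)
      obtain ⟨x, rfl⟩ := hz
      refine hf.disjoint_support x.2 ?_
      rw [← hF x, torusCover_mem_support_iff o hκ.1]
      exact ⟨d, b, hb, t₀, ht₀, h₀⟩
    obtain ⟨ε, hε, hball⟩ := hnear
    -- If the region contained the whole ray below `z`, some `z - n * I` would be congruent to a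
    -- point `z + w` near `z`. The covering is injective on the region, so w = -n * I, although ‖w‖
    -- < 1 ≤ n.
    obtain ⟨n, hn, w, hw, he⟩ := exists_return (Λ := Λ) hκ.1 (r := min ε 1) (by positivity)
    have h1 : z - ((n : ℝ) : ℂ) * I ∈ range F := hcon n (by exact_mod_cast hn)
    have h2 : z + w ∈ range F := hball (by
      rw [Metric.mem_ball, dist_eq_norm, add_sub_cancel_left]
      exact hw.trans_le (min_le_left _ _))
    have h3 := eq_of_mem_range_lift hF h1 h2 (by
      rw [sub_eq_add_neg, torusCover_add, torusCover_add]
      push_cast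
      rw [he])
    have h4 : w = -((n : ℝ) * I) := by linear_combination -h3
    have h5 : ‖w‖ = n := by
      rw [h4, norm_neg, norm_mul, Complex.norm_I, Complex.norm_real]
      simp
    have h6 : (1 : ℝ) ≤ n := by exact_mod_cast hn
    linarith [min_le_right ε 1]
  lift_unique v b hb b' hb' z hz hz' := by
    have h1 := eq_of_mem_range_lift hF hz hz' (by
      have h2 : torusCover Λ κ b + torusCover Λ κ (b' - b) = torusCover Λ κ b' := by
        rw [← torusCover_add]; congr 1; ring
      have h3 : torusCover Λ κ (b' - b) = 0 := by
        have h4 : torusCover Λ κ b' = torusCover Λ κ b := Eq.trans hb' (Eq.symm hb)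
        rw [h4] at h2
        exact left_eq_add.1 h2.symm
      rw [torusCover_add, h3, add_zero])
    linear_combination h1
  exists_angle p hp := by
    have := hG.contractible_of_isFace f hf
    have hne : ∀ x, F x - p ≠ 0 := fun x h => hp ⟨x, sub_eq_zero.1 h⟩
    let g : C(f, {z : ℂ // z ≠ 0}) :=
      ⟨fun x => ⟨F x - p, hne x⟩, (F.continuous.sub continuous_const).subtype_mk _⟩
    -- Contractibility gives a logarithm of `F - p`; its imaginary part is the angle.
    obtain ⟨A, hA⟩ := Complex.isCoveringMap_exp.exists_lift
      (fun z => ⟨Complex.log z.1, Subtype.ext (Complex.exp_log z.2)⟩) g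
    have hA' : ∀ x, exp (A x) = F x - p := fun x => congrArg Subtype.val (hA x)
    have hmem : ∀ z ∈ range F, torusCover Λ κ z ∈ f := by
      rintro _ ⟨x, rfl⟩
      rw [hF]; exact x.2
    classical
    refine ⟨fun z => if h : torusCover Λ κ z ∈ f then (A ⟨torusCover Λ κ z, h⟩).im else 0, ?_, ?_⟩
    · rw [continuousOn_iff_continuous_domRestrict]
      have : Continuous fun z : range F => (A ⟨torusCover Λ κ z, hmem z z.2⟩).im :=
        Complex.continuous_im.comp (A.continuous.comp
          (((isCoveringMap_torusCover hκ.1).continuous.comp continuous_subtype_val).subtype_mk _))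
      convert this using 2 with z
      simp [hmem z z.2]
    · rintro _ ⟨x, rfl⟩
      simp only [hF, Subtype.coe_prop, dif_pos, Subtype.coe_eta]
      rw [← hA' x, Complex.norm_exp]
      conv_lhs => rw [← Complex.re_add_im (A x), Complex.exp_add]
      rw [Complex.ofReal_exp]

/-- The sides of the lifted face are the boundary darts of the face. -/
theorem liesLeftOf_iff [Fintype E] [DiscreteTopology Λ] [IsZLattice ℝ Λ] (hG : G.IsToric)
    (o : G.PerfectOrientation) (hκ : G.IsGenericDirection κ) (hf : G.IsFace f)
    (F : C(f, ℂ)) (hF : ∀ x, torusCover Λ κ (F x) = x) (d : E × Bool) :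
    G.LiesLeftOf f d ↔ ∃ b, (liftedFace hG o hκ hf F hF).IsSide d b := by
  set R := liftedFace hG o hκ hf F hF with hR
  have hpt : ∀ b, torusCover Λ κ b = G.pos (G.dartSrc d) → ∀ t s : ℝ,
      torusCover Λ κ (b + (t + s * I) * (G.dartVec d / κ)) =
      G.pos (G.dartSrc d) +
        (QuotientAddGroup.mk (((t : ℂ) + (s : ℂ) * I) * G.dartVec d) : FlatTorus Λ) := by
    intro b hb t s
    rw [torusCover_add, hb]
    congr 1
    unfold torusCover
    congr 1
    have := hκ.1
    field_simp
  have htend : ∀ (b : ℂ) (t : ℝ), Tendsto (fun s : ℝ => b + (t + s * I) * (G.dartVec d / κ))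
      (𝓝[>] 0) (𝓝[R.leftHalf d b] (b + t * R.vec d)) := by
    intro b t
    refine tendsto_nhdsWithin_of_tendsto_nhds_of_eventually_within _ ?_ ?_
    · refine Tendsto.mono_left ?_ nhdsWithin_le_nhds
      exact Continuous.tendsto' (by fun_prop) _ _ (by simp [hR, liftedFace])
    · filter_upwards [self_mem_nhdsWithin] with s hs
      exact PlanarRegion.add_mul_mem_leftHalf (R := R) d b _ (by simpa using hs)
  constructor
  · intro h
    obtain ⟨a, ha⟩ := torusCover_surjective (Λ := Λ) hκ.1 (G.pos (G.dartSrc d))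
    have h2 := h (1 / 2) (by norm_num)
    obtain ⟨ε, hε, hε'⟩ := mem_nhdsGT_iff_exists_Ioc_subset.1 h2
    rw [mem_Ioi] at hε
    have hεf : ∀ s ∈ Ioc 0 ε,
        torusCover Λ κ (a + ((1 / 2 : ℝ) + s * I) * (G.dartVec d / κ)) ∈ f := by
      intro s hs
      rw [hpt a ha]
      exact hε' hs
    set z₁ := a + ((1 / 2 : ℝ) + ε * I) * (G.dartVec d / κ) with hz₁
    have hz₁f := hεf ε ⟨hε, le_rfl⟩
    -- An arbitrary lift `a` of the initial vertex is moved by the lattice translation that carries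
    -- `z₁` into the lifted face.
    set b := a + (F ⟨_, hz₁f⟩ - z₁) with hb
    have hlb : torusCover Λ κ (F ⟨_, hz₁f⟩ - z₁) = 0 := by
      have h3 : torusCover Λ κ (F ⟨_, hz₁f⟩ - z₁) + torusCover Λ κ z₁ = torusCover Λ κ z₁ := by
        rw [← torusCover_add, sub_add_cancel, hF]
      exact left_eq_add.1 (by rw [add_comm]; exact h3.symm)
    have hbpos : torusCover Λ κ b = G.pos (G.dartSrc d) := by
      rw [hb, torusCover_add, hlb, add_zero, ha]
    refine ⟨b, PlanarRegion.isSide_of_frequently (R := R) hbpos (τ := 1 / 2) (by norm_num) ?_⟩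
    have hsub : (fun s : ℝ => b + ((1 / 2 : ℝ) + s * I) * (G.dartVec d / κ)) '' Ioc 0 ε ⊆
        range F := by
      refine hf.subset_range_lift hκ.1 hF (isPreconnected_Ioc.image _ (by fun_prop)) ?_ ?_
      · rintro _ ⟨s, hs, rfl⟩
        refine hf.disjoint_support ?_
        have h3 := hεf s hs
        rw [hpt a ha] at h3
        simp only
        rw [hpt b hbpos]
        exact h3
      · refine ⟨F ⟨_, hz₁f⟩, ⟨ε, ⟨hε, le_rfl⟩, ?_⟩, mem_range_self _⟩
        simp only [hb, hz₁]
        ring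
    refine (htend b (1 / 2)).frequently (Eventually.frequently ?_)
    filter_upwards [Ioc_mem_nhdsGT hε] with s hs
    exact hsub ⟨s, hs, rfl⟩
  · rintro ⟨b, hb, hb'⟩ t ht
    filter_upwards [(htend b t).eventually (hb' t ht)] with s hs
    obtain ⟨x, hx⟩ := hs
    rw [← hpt b hb, ← hx, hF]
    exact x.2

/-- Almost every direction is generic. -/
theorem exists_isGenericDirection [DiscreteTopology Λ] [IsZLattice ℝ Λ] [Countable (W ⊕ B)] :
    ∃ κ, G.IsGenericDirection κ := by
  choose a ha using fun v => QuotientAddGroup.mk_surjective (G.pos v)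
  let δ : (W ⊕ B) × (W ⊕ B) × Λ → ℂ := fun x => a x.1 - a x.2.1 + x.2.2
  -- Two lifted vertices share a vertical for κ = 1 + it only if their difference δ satisfies t =
  -- -Re δ / Im δ, which excludes countably many t.
  have hcount : (range fun x => -(δ x).re / (δ x).im).Countable := countable_range _
  obtain ⟨t, ht⟩ : ∃ t : ℝ, t ∉ range fun x => -(δ x).re / (δ x).im := by
    by_contra! hcon
    exact Cardinal.not_countable_real (hcount.mono fun t _ => hcon t)
  have hκ : (1 + t * I : ℂ) ≠ 0 := by
    intro h
    have := congrArg Complex.re h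
    simp at this
  refine ⟨1 + t * I, hκ, fun v w p q hp hq hpq => ?_⟩
  by_contra hne
  have hmem : ∀ {u z}, torusCover Λ (1 + t * I) z = G.pos u → (1 + t * I) * z - a u ∈ Λ := by
    intro u z h
    rw [← ha, torusCover, QuotientAddGroup.eq, Submodule.mem_toAddSubgroup] at h
    have := Λ.neg_mem h
    rwa [neg_add_rev, neg_neg, add_comm, ← sub_eq_add_neg] at this
  let x : (W ⊕ B) × (W ⊕ B) × Λ := (v, w, ⟨_, Λ.sub_mem (hmem hp) (hmem hq)⟩)
  have hx : δ x = (1 + t * I) * (p - q) := by simp only [δ, x]; ring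
  have hre : (δ x).re = -t * (p - q).im := by rw [hx]; simp [hpq]
  have him : (δ x).im = (p - q).im := by rw [hx]; simp [hpq]
  have h0 : (p - q).im ≠ 0 := by
    intro h
    apply hne
    apply Complex.ext hpq
    simpa [sub_eq_zero] using h
  apply ht
  refine ⟨x, ?_⟩
  simp only
  rw [hre, him]
  field_simp

end StraightGraph


/-! ### The marking as a twisted coboundary of half-turns -/

theorem PlanarRegion.exists_isNext {V D : Type*} [Finite D] (R : PlanarRegion V D) :
    ∃ next : D → D, ∀ d, R.IsNext d (next d) := by
  suffices h : ∀ d, ∃ y, R.IsNext d y from ⟨fun d => (h d).choose, fun d => (h d).choose_spec⟩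
  intro d
  obtain ⟨y, hy, hmin⟩ := Set.exists_min_image {y | R.src y = R.src (R.rev d)}
    (fun y => ccwAngle (R.vec y) (R.vec (R.rev d))) (Set.toFinite _) ⟨R.rev d, rfl⟩
  exact ⟨y, hy, hmin⟩

namespace StraightGraph

variable {Λ : Submodule ℤ ℂ} {W B E : Type*} {G : StraightGraph Λ W B E}

theorem dartSrc_snd {d d' : E × Bool} (h : G.dartSrc d = G.dartSrc d') : d.2 = d'.2 := by
  rcases d with ⟨e, _ | _⟩ <;> rcases d' with ⟨e', _ | _⟩ <;> simp_all [dartSrc]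

/-- Two darts that leave a vertex in the same direction are equal. -/
theorem dart_eq_of_dartVec_eq (hG : G.IsToric) {d d' : E × Bool} (h : G.dartSrc d = G.dartSrc d')
    {r : ℝ} (hr : 0 < r) (hv : G.dartVec d = r * G.dartVec d') : d = d' := by
  have h2 := dartSrc_snd h
  refine Prod.ext ?_ h2
  have ht : 1 / (r + 1) ∈ Ioo (0 : ℝ) 1 :=
    ⟨by positivity, by rw [div_lt_one (by positivity)]; linarith⟩
  have htr : r / (r + 1) ∈ Ioo (0 : ℝ) 1 :=
    ⟨by positivity, by rw [div_lt_one (by positivity)]; linarith⟩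
  refine (hG.edgePoint_injective _ _ _ (ite_mem_Ioo d.2 ht) _ (ite_mem_Ioo d'.2 htr) ?_).1
  rw [← pos_add_dartVec, ← pos_add_dartVec, h, hv]
  congr 2
  push_cast
  ring

namespace PerfectOrientation

variable (o : G.PerfectOrientation)

/-- The dart on the black-to-white edge at the initial vertex of a dart. -/
def axisDart (d : E × Bool) : E × Bool := (if d.2 then o.pred d.1 else o.succ d.1, d.2)

theorem pred_spec (e : E) : G.white (o.pred e) = G.white e ∧ o.toBlack (o.pred e) = false :=
  Classical.choose_spec (o.existsUnique_in (G.white e)).exists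

theorem succ_spec (e : E) : G.black (o.succ e) = G.black e ∧ o.toBlack (o.succ e) = false :=
  Classical.choose_spec (o.existsUnique_out (G.black e)).exists

theorem dartSrc_axisDart (d : E × Bool) : G.dartSrc (o.axisDart d) = G.dartSrc d := by
  rcases d with ⟨e, _ | _⟩
  · simp [axisDart, dartSrc, (o.succ_spec e).1]
  · simp [axisDart, dartSrc, (o.pred_spec e).1]

theorem toBlack_axisDart (d : E × Bool) : o.toBlack (o.axisDart d).1 = false := by
  rcases d with ⟨e, _ | _⟩
  · exact (o.succ_spec e).2
  · exact (o.pred_spec e).2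

theorem eq_of_toBlack_eq_false {d d' : E × Bool} (h : G.dartSrc d = G.dartSrc d')
    (hd : o.toBlack d.1 = false) (hd' : o.toBlack d'.1 = false) : d = d' := by
  have h2 := dartSrc_snd h
  refine Prod.ext ?_ h2
  rcases d with ⟨e, _ | _⟩ <;> rcases d' with ⟨e', _ | _⟩ <;> simp_all only [reduceCtorEq]
  · exact (o.existsUnique_out (G.black e')).unique ⟨by simpa [dartSrc] using h, hd⟩ ⟨rfl, hd'⟩
  · exact (o.existsUnique_in (G.white e')).unique ⟨by simpa [dartSrc] using h, hd⟩ ⟨rfl, hd'⟩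

theorem axisDart_eq_iff {d : E × Bool} : o.axisDart d = d ↔ o.toBlack d.1 = false := by
  constructor
  · intro h
    rw [← h]
    exact o.toBlack_axisDart d
  · exact fun h => o.eq_of_toBlack_eq_false (o.dartSrc_axisDart d) (o.toBlack_axisDart d) h

theorem axisDart_congr {d d' : E × Bool} (h : G.dartSrc d = G.dartSrc d') :
    o.axisDart d = o.axisDart d' :=
  o.eq_of_toBlack_eq_false (by rw [dartSrc_axisDart, dartSrc_axisDart, h]) (o.toBlack_axisDart _)
    (o.toBlack_axisDart _)

/-- The vector of the black-to-white edge at the initial vertex of a dart, pointing away from that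
vertex. -/
def axis (d : E × Bool) : ℂ := G.dartVec (o.axisDart d)

theorem axis_ne_zero (hG : G.IsToric) (d : E × Bool) : o.axis d ≠ 0 := dartVec_ne_zero hG _

theorem ccwAngle_axis_eq_two_pi_iff (hG : G.IsToric) {d : E × Bool} :
    ccwAngle (G.dartVec d) (o.axis d) = 2 * Real.pi ↔ o.toBlack d.1 = false := by
  rw [← o.axisDart_eq_iff, ccwAngle_eq_two_pi_iff (dartVec_ne_zero hG _) (o.axis_ne_zero hG _)]
  constructor
  · rintro ⟨r, hr, h⟩
    exact dart_eq_of_dartVec_eq hG (o.dartSrc_axisDart d) hr h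
  · intro h
    exact ⟨1, one_pos, by rw [axis, h]; simp⟩

/-- Half of the angle at the initial vertex from the black-to-white edge to a dart. -/
def halfTurn (d : E × Bool) : ℂ := halfAngle (o.axis d) (G.dartVec d)

/-- `-1` on the black-to-white edges. -/
def edgeSign (d : E × Bool) : ℂ := if o.toBlack d.1 then 1 else -1

theorem marking_ne_zero (e : E) : o.marking e ≠ 0 := by
  unfold marking turn
  split_ifs
  · exact Complex.exp_ne_zero _
  · simp

theorem halfTurn_of_toBlack_eq_false (hG : G.IsToric) {d : E × Bool} (h : o.toBlack d.1 = false) :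
    o.halfTurn d = I := by
  rw [halfTurn, axis, o.axisDart_eq_iff.2 h, halfAngle, ccwAngle_self (dartVec_ne_zero hG d)]
  rw [show I / 2 * ((2 * Real.pi - Real.pi : ℝ) : ℂ) = Real.pi / 2 * I by push_cast; ring,
    Complex.exp_pi_div_two_mul_I]

/-- Each turning angle is the angle between `e` and an axis, shifted by π; at the black end it is
traversed in the opposite sense. The inversion is safe because the argument is π only if `e`
overlaps its successor, which embeddedness and the orientation exclude. -/
theorem turn_eq (hG : G.IsToric) {e : E} (h : o.toBlack e = true) :
    o.turn e = o.halfTurn (e, true) / o.halfTurn (e, false) := by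
  have hm : o.angleMinus e = ccwAngle (o.axis (e, true)) (G.dartVec (e, true)) - Real.pi := by
    simp only [angleMinus, edgeVec, h, (o.pred_spec e).2, ccwAngle, axis, axisDart, dartVec,
      Bool.false_eq_true, if_true, if_false]
    rw [div_neg, add_sub_cancel_right]
  have hp : o.anglePlus e = -(ccwAngle (o.axis (e, false)) (G.dartVec (e, false)) - Real.pi) := by
    have hne : arg (-(G.dartVec (e, false) / o.axis (e, false))) ≠ Real.pi := by
      intro h1
      have h2 : ccwAngle (o.axis (e, false)) (G.dartVec (e, false)) = 2 * Real.pi := by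
        rw [ccwAngle, h1]; ring
      rw [ccwAngle_eq_two_pi_iff (o.axis_ne_zero hG _) (dartVec_ne_zero hG _)] at h2
      obtain ⟨r, hr, h3⟩ := h2
      have h4 := dart_eq_of_dartVec_eq hG (o.dartSrc_axisDart (e, false)).symm hr h3
      have h5 := o.axisDart_eq_iff.1 h4.symm
      simp [h] at h5
    rw [ccwAngle, add_sub_cancel_right, ← (Complex.arg_inv _).trans (if_neg hne)]
    simp only [anglePlus, edgeVec, h, (o.succ_spec e).2, axis, axisDart, dartVec,
      Bool.false_eq_true, if_true, if_false]
    rw [← neg_inv, inv_div, neg_div_neg_eq, neg_div]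
  rw [turn, hm, hp, halfTurn, halfTurn, halfAngle, halfAngle, ← Complex.exp_sub]
  congr 1
  push_cast
  ring

theorem dartFactor_marking (hG : G.IsToric) (d : E × Bool) :
    dartFactor o.marking d = o.edgeSign d * (o.halfTurn d / o.halfTurn (dartRev d)) := by
  have key : ∀ e, o.marking e =
      o.edgeSign (e, true) * (o.halfTurn (e, true) / o.halfTurn (e, false)) := by
    intro e
    unfold marking edgeSign
    rcases h : o.toBlack e
    · rw [o.halfTurn_of_toBlack_eq_false hG (d := (e, true)) h,
        o.halfTurn_of_toBlack_eq_false hG (d := (e, false)) h]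
      simp
    · simp [o.turn_eq hG h]
  rcases d with ⟨e, _ | _⟩
  · simp only [dartFactor, Bool.false_eq_true, if_false, dartRev, Bool.not_false]
    rw [key, mul_inv, inv_div]
    congr 1
    unfold edgeSign
    split_ifs <;> norm_num
  · simp only [dartFactor, if_true, dartRev, Bool.not_true]
    rw [key]

/-- The square of the marking is the coboundary of this function of the initial vertex. -/
def direction (d : E × Bool) : ℂ := (if d.2 then 1 else -1) * (o.axis d / ‖o.axis d‖)

theorem direction_ne_zero (hG : G.IsToric) (d : E × Bool) : o.direction d ≠ 0 := by
  have := o.axis_ne_zero hG d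
  unfold direction
  refine mul_ne_zero ?_ (div_ne_zero this (by simpa using this))
  split_ifs <;> simp

theorem direction_congr {d d' : E × Bool} (h : G.dartSrc d = G.dartSrc d') :
    o.direction d = o.direction d' := by
  rw [direction, direction, axis, axis, o.axisDart_congr h, dartSrc_snd h]

/-- The vector of `d` cancels against that of its reverse up to -1; the colour sign in `direction`
absorbs this -1. -/
theorem dartFactor_marking_sq (hG : G.IsToric) (d : E × Bool) :
    dartFactor o.marking d ^ 2 = o.direction (dartRev d) / o.direction d := by
  have hs : o.edgeSign d ^ 2 = 1 := by unfold edgeSign; split_ifs <;> norm_num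
  have h1 := o.axis_ne_zero hG d
  have h2 := o.axis_ne_zero hG (dartRev d)
  have h3 := dartVec_ne_zero hG d
  have h1' : (‖o.axis d‖ : ℂ) ≠ 0 := by simpa using h1
  have h2' : (‖o.axis (dartRev d)‖ : ℂ) ≠ 0 := by simpa using h2
  have h3' : (‖G.dartVec d‖ : ℂ) ≠ 0 := by simpa using h3
  rw [o.dartFactor_marking hG, mul_pow, hs, one_mul, div_pow, halfTurn, halfTurn,
    halfAngle_sq h1 h3, halfAngle_sq h2 (dartVec_ne_zero hG _), dartVec_dartRev, norm_neg,
    direction, direction]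
  rcases d with ⟨e, _ | _⟩ <;> simp only [dartRev, Bool.not_false, Bool.not_true, if_true,
    Bool.false_eq_true, if_false] at * <;> field_simp

theorem prod_dartFactor_marking_sq (hG : G.IsToric) {n : ℕ} {d : ℕ → E × Bool}
    (h : ∀ i < n, G.dartDst (d i) = G.dartSrc (d (i + 1))) :
    (∏ i ∈ Finset.range n, dartFactor o.marking (d i)) ^ 2 =
      o.direction (d n) / o.direction (d 0) := by
  induction n with
  | zero => simp [o.direction_ne_zero hG]
  | succ n ih =>
    rw [Finset.prod_range_succ, mul_pow, ih fun i hi => h i (by omega),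
      o.dartFactor_marking_sq hG,
      o.direction_congr (d := dartRev (d n)) ((dartSrc_dartRev _).trans (h n (by omega)))]
    have := o.direction_ne_zero hG (d n)
    have := o.direction_ne_zero hG (d 0)
    field_simp

/-- The two darts share a vertex, hence a cut. As no dart lies inside the corner, the cut
contributes a sign only if it runs along `y`, that is, if `y` is black-to-white. -/
theorem halfTurn_div_halfTurn (hG : G.IsToric) {d y : E × Bool}
    (hy : G.dartSrc y = G.dartSrc (dartRev d))
    (hle : ∀ w, G.dartSrc w = G.dartSrc (dartRev d) →
      ccwAngle (G.dartVec y) (G.dartVec (dartRev d)) ≤ ccwAngle (G.dartVec y) (G.dartVec w)) :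
    o.halfTurn y / o.halfTurn (dartRev d) =
      exp (-(I / 2) * ccwAngle (G.dartVec y) (G.dartVec (dartRev d))) * o.edgeSign y := by
  have hax : o.axis (dartRev d) = o.axis y := by rw [axis, axis, o.axisDart_congr hy]
  have h1 := hle (o.axisDart y) ((o.dartSrc_axisDart y).trans hy)
  rw [halfTurn, halfTurn, hax, halfAngle_div_halfAngle (dartVec_ne_zero hG _)
    (dartVec_ne_zero hG _) (o.axis_ne_zero hG _), edgeSign]
  congr 1
  have h3 := o.ccwAngle_axis_eq_two_pi_iff hG (d := y)
  have h2 : ¬ ccwAngle (G.dartVec y) (o.axis y) < ccwAngle (G.dartVec y) (G.dartVec (dartRev d)) :=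
    not_lt.2 h1
  rcases h : o.toBlack y.1 <;> simp [h2, h3, h]

theorem card_and_prod_faceBoundary [Fintype E] [DiscreteTopology Λ] [IsZLattice ℝ Λ]
    (hG : G.IsToric) {f : Set (FlatTorus Λ)} (hf : G.IsFace f) :
    ∃ m : ℕ, G.faceLength f = 2 * m ∧
      ∏ d ∈ G.faceBoundary f, dartFactor o.marking d = (-1) ^ (m + 1) := by
  classical
  have : Finite (W ⊕ B) := Finite.of_surjective G.dartSrc (exists_dart o)
  obtain ⟨κ, hκ⟩ := exists_isGenericDirection (G := G)
  have := hG.contractible_of_isFace f hf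
  obtain ⟨F, hF⟩ := (isCoveringMap_torusCover (Λ := Λ) hκ.1).exists_lift
    (torusCover_surjective hκ.1) (⟨Subtype.val, continuous_subtype_val⟩ : C(f, FlatTorus Λ))
  let R := liftedFace hG o hκ hf F hF
  obtain ⟨next, hn⟩ := R.exists_isNext
  let S := G.faceBoundary f
  have hS : ∀ d, d ∈ S ↔ ∃ b, R.IsSide d b := by
    intro d
    rw [← liesLeftOf_iff hG o hκ hf F hF d]
    simp [S, faceBoundary]
  have hmaps : ∀ d ∈ S, next d ∈ S := by
    intro d hd
    obtain ⟨b, hb⟩ := (hS d).1 hd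
    exact (hS _).2 ⟨_, hb.next hn⟩
  have hinj : Set.InjOn next S := fun a _ b _ hab => (hn a).left_unique (hab ▸ hn b)
  have hsurj := Finset.surjOn_of_injOn_of_card_le next hmaps hinj le_rfl
  have hprod : ∀ g : E × Bool → ℂ, ∏ d ∈ S, g (next d) = ∏ d ∈ S, g d := fun g =>
    Finset.prod_nbij next hmaps hinj hsurj fun _ _ => rfl
  have hsrc : ∀ d, G.dartSrc (next d) = G.dartSrc (dartRev d) := fun d => (hn d).1
  have hflip : ∀ d, (next d).2 = !d.2 := fun d => dartSrc_snd (hsrc d)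
  -- The successor permutes the sides and exchanges the two colours of initial vertex, so the length
  -- is even.
  have hcard : (S.filter fun d => d.2 = true).card = (S.filter fun d => ¬ d.2 = true).card := by
    rw [Finset.card_filter, Finset.card_filter]
    refine (Finset.sum_nbij next hmaps hinj hsurj fun d _ => ?_).symm
    simp [hflip]
  have hsplit := S.card_filter_add_card_filter_not (fun d => d.2 = true)
  have hm : S.card = 2 * (S.filter fun d => d.2 = true).card := by omega
  refine ⟨_, hm, ?_⟩
  rw [← R.prod_exp_corner_angle hn S hS hm]
  have hangle : ∀ y x, ccwAngle (R.vec y) (R.vec x) = ccwAngle (G.dartVec y) (G.dartVec x) :=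
    fun y x => ccwAngle_div _ _ hκ.1
  have hstep : ∀ d, o.halfTurn (next d) / o.halfTurn (dartRev d) =
      exp (-(I / 2) * ccwAngle (R.vec (next d)) (R.vec (R.rev d))) * o.edgeSign (next d) := by
    intro d
    rw [o.halfTurn_div_halfTurn hG (hsrc d), hangle]
    · rfl
    · intro w hw
      rw [← hangle, ← hangle]
      exact (hn d).le_ccwAngle hw
  have hsign : (∏ d ∈ S, o.edgeSign d) * ∏ d ∈ S, o.edgeSign d = 1 := by
    rw [← Finset.prod_mul_distrib]
    refine Finset.prod_eq_one fun d _ => ?_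
    unfold edgeSign
    split_ifs <;> norm_num
  -- Shifting the numerators by `next` regroups the half-turns by corners; the corner signs then
  -- multiply with the edge signs to 1.
  rw [Finset.prod_congr rfl fun d _ => o.dartFactor_marking hG d, Finset.prod_mul_distrib,
    Finset.prod_div_distrib, ← hprod o.halfTurn, ← Finset.prod_div_distrib,
    Finset.prod_congr rfl fun d _ => hstep d, Finset.prod_mul_distrib, hprod o.edgeSign,
    mul_left_comm, hsign, mul_one]

end PerfectOrientation

end StraightGraph

end

theorem proposition3 {Λ : Submodule ℤ ℂ} [DiscreteTopology Λ] [IsZLattice ℝ Λ]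
    {W B E : Type*} [Fintype E]
    (G : StraightGraph Λ W B E) (hG : G.IsToric) (hleaf : G.IsLeafless)
    (o : G.PerfectOrientation) :
    G.IsFractionalKasteleynMarking o.marking := by
  refine ⟨o.marking_ne_zero, fun f hf => o.card_and_prod_faceBoundary hG hf, fun n d h => ?_⟩
  rw [← sq_eq_one_iff, o.prod_dartFactor_marking_sq hG h.1, h.2,
    div_self (o.direction_ne_zero hG _)]
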